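/- **Setting.** Let $\{\psi_{lk}: l\ge 0,\ k\in\mathcal K_l\}$ be an orthonormal boundary-corrected wavelet basis of $L^2[0,1]$: there are integers $J,N\ge 0$ with $2N\le 2^J$ such that for $l\ge J$ one has $\mathcal K_l=\{0,\dots,2^l-1\}$ and, on $[0,1]$, $$\psi_{lk}(x)=\begin{cases}2^{l/2}\,\psi^{\mathrm{left}}_k(2^lx), & k<N,\\ 2^{l/2}\,\psi(2^lx-k), & N\le k<2^l-N,\\ 2^{l/2}\,\psi^{\mathrm{right}}_{2^l-1-k}(2^l(x-1)), & k\ge 2^l-N,\end{cases}$$ with bounded, measurable, compactly supported functions $\psi,\psi^{\mathrm{left}}_i,\psi^{\mathrm{right}}_i$ on $\mathbb R$, while for $l<J$ the sets $\mathcal K_l$ are finite and the $\psi_{lk}$ (the scaling functions and possibly some coarser wavelets) are bounded measurable functions. Write $f_{lk}=\int_0^1 f\psi_{lk}$ for the coefficients of $f\in L^2[0,1]$ and identify $f$ with $(f_{lk})$; $\|\cdot\|_\infty$ is the norm of $L^\infty[0,1]$. For $\beta,L>0$ let $$\mathcal H^\beta(L)=\Big\{f=(f_{lk}):\ |f_{lk}|\le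 2^{-l(1/2+\beta)}L\ \text{ for all } l\ge 0,\ k\in\mathcal K_l\Big\}.$$ Given $f$, the data $X^{(n)}=(X_{lk})$ are independent with $X_{lk}\sim\mathcal N(f_{lk},1/n)$ (the Gaussian white noise model in sequence form); $E_{f_0}$ denotes expectation when $X^{(n)}$ is generated from $f=f_0$. Let $H$ be a probability law on $\mathbb R$ with a density $h$ that is symmetric, positive, bounded, decreasing on $[0,\infty)$ and satisfies, for some $c_1>0$ and $\kappa\ge0$, $$\log(1/h(x))\le c_1\big(1+\log^{1+\kappa}(1+x)\big),\qquad x\ge 0,$$ and assume $\int_{-\infty}^{\infty}|x|^q h(x)\,dx<\infty$ for some real $q\ge1$. For a positive sequence $(s_l)$, the prior $\Pi$ is the law of $f=(f_{lk})$ with $f_{lk}=s_l\zeta_{lk}$, where the $\zeta_{lk}$ are i.i.d. with law $H$, and $\Pi[\cdot\,|\,X^{(n)}]$ is the posterior distribution (the conditional law of $f$ given $X^{(n)}$ when $f\sim\Pi$). **Theorem.** Let $\beta,L>0$. (i) If $s_l=2^{-l^2}$, there is $d>0$ such that for every $f_0\in\mathcal H^\beta(L)$, as $n\to\infty$, $$E_{f_0}\,\Pi\Big[\big\{f:\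 \|f-f_0\|_\infty>(\log n)^d\,(\log n/n)^{\beta/(2\beta+1)}\big\}\,\Big|\,X^{(n)}\Big]\to0 .$$ (ii) The same holds, with a possibly different $d$, if $s_l=2^{-l(1/2+\alpha)}$ for some $\alpha\ge\beta+1/q$. -/

import Mathlib

open MeasureTheory ProbabilityTheory Filter Topology
open scoped ENNReal NNReal

/-- The generators of a boundary-corrected wavelet system on `[0,1]`, with coarsest level `J`.
At the levels `l ≥ J` there are `2 ^ l` functions: dilated translates of one compactly supported
mother wavelet in the interior, and `N` dilated edge functions at each of the two end points.
The finitely many remaining functions (the scaling functions, and possibly some coarser wavelets)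
are bounded and are labelled by levels `l < J`, in any way, `coarseCard l` of them at level `l`. -/
structure BoundaryWavelets where
  /-- the coarsest level of the wavelets described by the generators -/
  J : ℕ
  /-- the number of edge wavelets at each end point -/
  N : ℕ
  two_mul_N_le : 2 * N ≤ 2 ^ J
  /-- the mother wavelet, on the real line -/
  mother : ℝ → ℝ
  /-- the edge wavelets at `0`, used at the indices `i < N` -/
  left : ℕ → ℝ → ℝ
  /-- the edge wavelets at `1` (translated to `0`), used at the indices `i < N` -/
  right : ℕ → ℝ → ℝ
  /-- the number of coarse functions at each level `l < J` -/
  coarseCard : ℕ → ℕ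
  /-- the coarse functions -/
  coarse : ℕ → ℕ → ℝ → ℝ
  measurable_mother : Measurable mother
  bounded_mother : ∃ C : ℝ, ∀ x, |mother x| ≤ C
  hasCompactSupport_mother : HasCompactSupport mother
  measurable_left : ∀ i, Measurable (left i)
  bounded_left : ∀ i, ∃ C : ℝ, ∀ x, |left i x| ≤ C
  hasCompactSupport_left : ∀ i, HasCompactSupport (left i)
  measurable_right : ∀ i, Measurable (right i)
  bounded_right : ∀ i, ∃ C : ℝ, ∀ x, |right i x| ≤ C
  hasCompactSupport_right : ∀ i, HasCompactSupport (right i)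
  measurable_coarse : ∀ l k, Measurable (coarse l k)
  bounded_coarse : ∀ l k, ∃ C : ℝ, ∀ x, |coarse l k x| ≤ C

/-- Lebesgue measure on `[0,1]`. -/
noncomputable def unitMeasure : Measure ℝ := volume.restrict (Set.Icc (0 : ℝ) 1)

namespace BoundaryWavelets

/-- The number of functions at level `l`. -/
def card (B : BoundaryWavelets) (l : ℕ) : ℕ := if l < B.J then B.coarseCard l else 2 ^ l

/-- The double indices `(l, k)`: level `l`, position `k`. -/
abbrev Index (B : BoundaryWavelets) : Type := Σ l : ℕ, Fin (B.card l)

/-- The function `ψ_{lk}` (as a function on `[0,1]`). -/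
noncomputable def psi (B : BoundaryWavelets) (i : B.Index) (x : ℝ) : ℝ :=
  let l := i.1
  let k : ℕ := i.2
  if l < B.J then B.coarse l k x
  else (2 : ℝ) ^ ((l : ℝ) / 2) *
    (if k < B.N then B.left k ((2 : ℝ) ^ l * x)
    else if 2 ^ l ≤ k + B.N then B.right (2 ^ l - 1 - k) ((2 : ℝ) ^ l * (x - 1))
    else B.mother ((2 : ℝ) ^ l * x - k))

/-- The functions `ψ_{lk}` form an orthonormal basis of `L²[0,1]`. -/
structure IsOrthonormalBasis (B : BoundaryWavelets) : Prop where
  norm_sq : ∀ i, ∫ x, B.psi i x * B.psi i x ∂unitMeasure = 1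
  orthogonal : ∀ i j, i ≠ j → ∫ x, B.psi i x * B.psi j x ∂unitMeasure = 0
  complete : ∀ F : ℝ → ℝ, MemLp F 2 unitMeasure →
    (∀ i, ∫ x, F x * B.psi i x ∂unitMeasure = 0) → F =ᵐ[unitMeasure] 0

/-- The supremum norm on `[0,1]` of the function of `L²[0,1]` whose sequence of coefficients
is `g`. It is `∞` when `g` is not the sequence of coefficients of a function of `L²[0,1]` (the
infimum is over the empty set) or when this function is not essentially bounded. -/
noncomputable def supNorm (B : BoundaryWavelets) (g : B.Index → ℝ) : ℝ≥0∞ :=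
  ⨅ F ∈ {F : ℝ → ℝ | MemLp F 2 unitMeasure ∧ ∀ i, ∫ x, F x * B.psi i x ∂unitMeasure = g i},
    eLpNorm F ∞ unitMeasure

/-- The Hölder-type ball `H^β(L)`, in terms of coefficients. -/
def holderBall (B : BoundaryWavelets) (β L : ℝ) : Set (B.Index → ℝ) :=
  {f | ∀ i : B.Index, |f i| ≤ (2 : ℝ) ^ (-((i.1 : ℝ) * (1 / 2 + β))) * L}

/-- The series prior: the law of `(s_l ζ_{lk})` with `ζ_{lk}` independent of common law `H`. -/
noncomputable def prior (B : BoundaryWavelets) (H : Measure ℝ) [IsProbabilityMeasure H]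
    (s : ℕ → ℝ) : Measure (B.Index → ℝ) :=
  (Measure.infinitePi (fun _ : B.Index => H)).map (fun ζ i => s i.1 * ζ i)

instance (B : BoundaryWavelets) (H : Measure ℝ) [IsProbabilityMeasure H] (s : ℕ → ℝ) :
    IsProbabilityMeasure (B.prior H s) :=
  Measure.isProbabilityMeasure_map
    (measurable_pi_lambda _ fun i : B.Index => (measurable_pi_apply i).const_mul (s i.1)).aemeasurable

theorem infinitePi_gaussianReal_eq_map {ι : Type*} (f : ι → ℝ) (v : ℝ≥0) :
    Measure.infinitePi (fun i => gaussianReal (f i) v) =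
      (Measure.infinitePi (fun _ : ι => gaussianReal 0 v)).map (fun ξ => f + ξ) := by
  have h := Measure.infinitePi_map_pi (μ := fun _ : ι => gaussianReal 0 v)
    (f := fun i x => f i + x) (fun i => by fun_prop)
  have h2 : ∀ i, (gaussianReal 0 v).map (fun x => f i + x) = gaussianReal (f i) v := by
    intro i
    simpa using gaussianReal_map_const_add (μ := 0) (v := v) (f i)
  simp only [h2] at h
  exact h.symm

theorem measurable_infinitePi_gaussianReal {ι : Type*} (v : ℝ≥0) :
    Measurable (fun f : ι → ℝ => Measure.infinitePi (fun i => gaussianReal (f i) v)) := by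
  have h : (fun f : ι → ℝ => Measure.infinitePi (fun i => gaussianReal (f i) v)) =
      fun f => ((Measure.infinitePi (fun _ : ι => gaussianReal 0 v)).map (Prod.mk f)).map
        (fun p : (ι → ℝ) × (ι → ℝ) => p.1 + p.2) := by
    funext f
    rw [infinitePi_gaussianReal_eq_map, Measure.map_map (by fun_prop) (by fun_prop)]
    rfl
  rw [h]
  exact (Measure.measurable_map _ (by fun_prop)).comp Measurable.map_prodMk_left

/-- The white noise model in sequence form: given `f`, the observations `X_{lk}` are independent
with laws `N(f_{lk}, 1/n)`. -/
noncomputable def model (B : BoundaryWavelets) (n : ℕ) : Kernel (B.Index → ℝ) (B.Index → ℝ) where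
  toFun f := Measure.infinitePi (fun i => gaussianReal (f i) ((n : ℝ≥0)⁻¹))
  measurable' := measurable_infinitePi_gaussianReal _

instance (B : BoundaryWavelets) (n : ℕ) : IsMarkovKernel (B.model n) :=
  ⟨fun f => inferInstanceAs
    (IsProbabilityMeasure (Measure.infinitePi (fun i => gaussianReal (f i) ((n : ℝ≥0)⁻¹))))⟩

/-- The expectation, over data `X` from the model at `f₀`, of the posterior mass
`Π[{f : ‖f - f₀‖_∞ > r} | X]`. -/
noncomputable def expectedMassOutside (B : BoundaryWavelets) (P : Measure (B.Index → ℝ))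
    [IsFiniteMeasure P] (n : ℕ) (f₀ : B.Index → ℝ) (r : ℝ) : ℝ≥0∞ :=
  ∫⁻ X, posterior (B.model n) P X {f | ENNReal.ofReal r < B.supNorm (f - f₀)} ∂(B.model n f₀)

end BoundaryWavelets

/-- The conditions on the heavy-tailed density `h`, apart from being a density. -/
structure IsHeavyTailed (h : ℝ → ℝ) (c₁ κ : ℝ) : Prop where
  symm : ∀ x, h (-x) = h x
  pos : ∀ x, 0 < h x
  bounded : ∃ C : ℝ, ∀ x, h x ≤ C
  antitoneOn : AntitoneOn h (Set.Ici 0)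
  log_le : ∀ x, 0 ≤ x → Real.log (1 / h x) ≤ c₁ * (1 + Real.log (1 + x) ^ (1 + κ))

/-- The scaling `s_l = 2^{-l²}`. -/
noncomputable def otScale (l : ℕ) : ℝ := (2 : ℝ) ^ (-((l : ℝ) ^ 2))

/-- The scaling `s_l = 2^{-l(1/2+α)}`. -/
noncomputable def htScale (α : ℝ) (l : ℕ) : ℝ := (2 : ℝ) ^ (-((l : ℝ) * (1 / 2 + α)))

/-- The rate `(log n)^d (log n / n)^{β/(2β+1)}`. -/
noncomputable def supRate (d β : ℝ) (n : ℕ) : ℝ :=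
  Real.log n ^ d * (Real.log n / n) ^ (β / (2 * β + 1))

/-! ### Shifts of Gaussian product measures and their absolute continuity. -/

section GaussianShift

/-! At each level the wavelets overlap boundedly, so `‖f - f₀‖_∞` is at most a constant times the
sum over `l` of `2^{l/2}` times a bound for the level-`l` coefficients of `f - f₀`
(`exists_supNorm_le`). It is enough to control every coefficient separately and to take a union
bound. Prior and noise are both product measures, so the posterior law of one coefficient is given
by Bayes' formula in dimension one and involves only its own observation (`posterior_eval_ae_eq`).
The posterior is determined only up to null sets of the marginal law of the data. The formula may
still be used under `f₀`: a prior draw is almost surely at square summable distance from `f₀`, and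
the data laws at two such sequences are absolutely continuous (`lintegral_posterior_eval`).

Levels are cut at `m` with `2^{m(1/2+β)}` of order `√n log n`. Below the cut, a coefficient should
be within `2M` of the truth, `M = (log n)^{2+κ}/√n`. The prior gives a ball of radius `1/√n` near
the truth mass at least `exp(-A (log n)^{2+2κ})/√n` up to a constant: this is where the heavy tails
matter, since `log (1/s_l)` is only of order `(log n)^2` there. The Gaussian factor `exp(-n M²/2) =
exp(-(log n)^{4+2κ}/2)` beats this cost and the polynomial number of coefficients
(`coordPosterior_le_of_ball`, `tendsto_low_level_bound`).

Above the cut, signal and prior scale are at most of the order of the noise level. There the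
posterior mass of a set is, in expectation, at most a constant times its prior mass plus a Gaussian
tail (`lintegral_coordPosterior_le_of_symmetric`). The moment of order `q` makes the prior
probability of exceeding `tailScale` summable over all coefficients (`mul_div_tailScale_rpow_le`).

Only two properties of the scaling are used, and both choices have them: `s_l` is at most a constant
times `2^{-l(1/2+β+1/q)}`, and `log (1/s_l)` is at most a constant times `(l+1)²`. -/

theorem lintegral_exp_mul_gaussianReal (μ : ℝ) (v : ℝ≥0) (t : ℝ) :
    ∫⁻ x, ENNReal.ofReal (Real.exp (t * x)) ∂gaussianReal μ v =
      ENNReal.ofReal (Real.exp (μ * t + v * t ^ 2 / 2)) := by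
  rw [← ofReal_integral_eq_lintegral_ofReal (integrable_exp_mul_gaussianReal t)
    (ae_of_all _ fun x => (Real.exp_pos _).le)]
  congr 1
  exact congrFun (mgf_id_gaussianReal (μ := μ) (v := v)) t

/-- The likelihood ratio of `N(b, v)` relative to `N(a, v)`. -/
noncomputable def gaussianRatio (v : ℝ≥0) (a b x : ℝ) : ℝ≥0∞ :=
  ENNReal.ofReal (Real.exp (((b - a) * x - (b ^ 2 - a ^ 2) / 2) / v))

theorem measurable_gaussianRatio_right (v : ℝ≥0) (a b : ℝ) :
    Measurable (gaussianRatio v a b) := by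
  unfold gaussianRatio; fun_prop

theorem gaussianPDF_eq_mul_gaussianRatio {v : ℝ≥0} (hv : v ≠ 0) (a b x : ℝ) :
    gaussianPDF b v x = gaussianPDF a v x * gaussianRatio v a b x := by
  have hv' : (v : ℝ) ≠ 0 := by exact_mod_cast hv
  rw [gaussianPDF, gaussianPDF, gaussianRatio, ← ENNReal.ofReal_mul (gaussianPDFReal_nonneg _ _ _),
    gaussianPDFReal, gaussianPDFReal, mul_assoc (√_)⁻¹, ← Real.exp_add]
  congr 3
  field_simp
  ring

theorem gaussianReal_eq_withDensity {v : ℝ≥0} (hv : v ≠ 0) (a b : ℝ) :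
    gaussianReal b v = (gaussianReal a v).withDensity (gaussianRatio v a b) := by
  rw [gaussianReal_of_var_ne_zero _ hv, gaussianReal_of_var_ne_zero _ hv, ← withDensity_mul]
  · congr 1
    funext x
    exact gaussianPDF_eq_mul_gaussianRatio hv a b x
  · exact measurable_gaussianPDF _ _
  · exact measurable_gaussianRatio_right v a b

theorem lintegral_gaussianRatio_sq {v : ℝ≥0} (hv : v ≠ 0) (a b : ℝ) :
    ∫⁻ x, gaussianRatio v a b x ^ 2 ∂gaussianReal a v =
      ENNReal.ofReal (Real.exp ((b - a) ^ 2 / v)) := by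
  have hv' : (v : ℝ) ≠ 0 := by exact_mod_cast hv
  have h : ∀ x, gaussianRatio v a b x ^ 2 =
      ENNReal.ofReal (Real.exp (-(b ^ 2 - a ^ 2) / v)) *
        ENNReal.ofReal (Real.exp ((2 * (b - a) / v) * x)) := by
    intro x
    rw [gaussianRatio, ← ENNReal.ofReal_pow (Real.exp_pos _).le, ← Real.exp_nat_mul,
      ← ENNReal.ofReal_mul (Real.exp_pos _).le, ← Real.exp_add]
    congr 2
    field_simp
    push_cast
    ring
  simp_rw [h]
  rw [lintegral_const_mul _ (by fun_prop), lintegral_exp_mul_gaussianReal,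
    ← ENNReal.ofReal_mul (Real.exp_pos _).le, ← Real.exp_add]
  congr 2
  field_simp
  ring

/-- Cauchy–Schwarz against the likelihood ratio, whose second moment is explicit. This form of a
chi-square bound is chosen because it tensorises. -/
theorem lintegral_gaussianReal_sq_le {v : ℝ≥0} (hv : v ≠ 0) (a b : ℝ) {g : ℝ → ℝ≥0∞}
    (hg : Measurable g) :
    (∫⁻ x, g x ∂gaussianReal b v) ^ 2 ≤
      ENNReal.ofReal (Real.exp ((b - a) ^ 2 / v)) * ∫⁻ x, g x ^ 2 ∂gaussianReal a v := by
  have hr : Measurable (gaussianRatio v a b) :=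
    measurable_gaussianRatio_right v a b
  rw [gaussianReal_eq_withDensity hv a b, lintegral_withDensity_eq_lintegral_mul _ hr hg]
  have := ENNReal.lintegral_mul_le_Lp_mul_Lq (gaussianReal a v) Real.HolderConjugate.two_two
    hr.aemeasurable hg.aemeasurable
  refine (pow_le_pow_left' this 2).trans (le_of_eq ?_)
  rw [mul_pow, ← lintegral_gaussianRatio_sq hv a b]
  simp only [ENNReal.rpow_two, ← ENNReal.rpow_natCast, ← ENNReal.rpow_mul]
  norm_num

open Classical in
theorem lmarginal_sq_le {ι : Type*} {X : ι → Type*} [∀ i, MeasurableSpace (X i)]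
    {P Q : ∀ i, Measure (X i)} [∀ i, SigmaFinite (P i)] [∀ i, SigmaFinite (Q i)] {C : ι → ℝ≥0∞}
    (hC : ∀ i, ∀ g : X i → ℝ≥0∞, Measurable g →
      (∫⁻ x, g x ∂P i) ^ 2 ≤ C i * ∫⁻ x, g x ^ 2 ∂Q i)
    (s : Finset ι) {g : (∀ i, X i) → ℝ≥0∞} (hg : Measurable g) (x : ∀ i, X i) :
    (lmarginal P s g x) ^ 2 ≤ (∏ i ∈ s, C i) * lmarginal Q s (fun y => g y ^ 2) x := by
  induction s using Finset.induction_on generalizing x with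
  | empty => simp
  | insert i s his ih =>
    have h2 : Measurable (fun y => g y ^ 2) := hg.pow_const 2
    rw [lmarginal_insert _ hg his, lmarginal_insert _ h2 his, Finset.prod_insert his, mul_assoc]
    refine (hC i _ ((hg.lmarginal P).comp (measurable_update x))).trans ?_
    gcongr
    have h3 : Measurable fun y => lmarginal Q s (fun y => g y ^ 2) (Function.update x i y) :=
      (h2.lmarginal Q).comp (measurable_update x)
    rw [← lintegral_const_mul _ h3]
    exact lintegral_mono fun y => ih _

/-- An indicator is its own square, so the tensorised inequality for functions becomes one between
probabilities of cylinders. -/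
theorem infinitePi_cylinder_sq_le {ι : Type*} {X : ι → Type*} [∀ i, MeasurableSpace (X i)]
    {P Q : ∀ i, Measure (X i)} [∀ i, IsProbabilityMeasure (P i)]
    [∀ i, IsProbabilityMeasure (Q i)] {C : ι → ℝ≥0∞}
    (hC : ∀ i, ∀ g : X i → ℝ≥0∞, Measurable g →
      (∫⁻ x, g x ∂P i) ^ 2 ≤ C i * ∫⁻ x, g x ^ 2 ∂Q i)
    (s : Finset ι) {S : Set (∀ i : s, X i)} (hS : MeasurableSet S) :
    (Measure.infinitePi P (cylinder s S)) ^ 2 ≤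
      (∏ i ∈ s, C i) * Measure.infinitePi Q (cylinder s S) := by
  classical
  have hne : Nonempty (∀ i, X i) := by
    have : ∀ i, Nonempty (X i) := fun i => (P i).nonempty_of_neZero
    infer_instance
  obtain ⟨x⟩ := hne
  have hm : MeasurableSet (cylinder s S) := hS.cylinder
  have key : ∀ (R : ∀ i, Measure (X i)) [∀ i, IsProbabilityMeasure (R i)],
      Measure.infinitePi R (cylinder s S) =
        lmarginal R s ((cylinder s S).indicator (fun _ => 1)) x := by
    intro R _
    rw [Measure.infinitePi_cylinder _ hS, lmarginal, ← lintegral_indicator_one hS]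
    refine lintegral_congr fun y => ?_
    simp only [Set.indicator, mem_cylinder]
    congr 1
    have : s.restrict (Function.updateFinset x s y) = y := by
      funext i; simp [Function.updateFinset]
    rw [this]
  rw [key, key]
  refine (lmarginal_sq_le hC s (measurable_const.indicator hm) x).trans (le_of_eq ?_)
  congr 2
  funext y
  by_cases hy : y ∈ cylinder s S <;> simp [hy]

/-- The easy half of Kakutani's dichotomy. The bound `P(A)² ≤ K Q(A)` holds for cylinders with one
constant `K`, and a general set is approximated by cylinders for `P + Q`. -/
theorem infinitePi_absolutelyContinuous {ι : Type*} {X : ι → Type*} [∀ i, MeasurableSpace (X i)]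
    {P Q : ∀ i, Measure (X i)} [∀ i, IsProbabilityMeasure (P i)]
    [∀ i, IsProbabilityMeasure (Q i)] {C : ι → ℝ≥0∞}
    (hC : ∀ i, ∀ g : X i → ℝ≥0∞, Measurable g →
      (∫⁻ x, g x ∂P i) ^ 2 ≤ C i * ∫⁻ x, g x ^ 2 ∂Q i)
    {K : ℝ≥0∞} (hK : K ≠ ∞) (hCK : ∀ s : Finset ι, ∏ i ∈ s, C i ≤ K) :
    Measure.infinitePi P ≪ Measure.infinitePi Q := by
  refine Measure.AbsolutelyContinuous.mk fun A hA hQ => ?_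
  set p := Measure.infinitePi P
  set q := Measure.infinitePi Q
  have hlim : Tendsto (fun ε : ℝ≥0∞ => (K * ε) ^ (1 / 2 : ℝ) + ε) (𝓝 0) (𝓝 0) := by
    have : Tendsto (fun ε : ℝ≥0∞ => (K * ε) ^ (1 / 2 : ℝ) + ε) (𝓝 0)
        (𝓝 ((K * 0) ^ (1 / 2 : ℝ) + 0)) := by
      refine Tendsto.add ?_ tendsto_id
      exact ((ENNReal.continuous_rpow_const (y := 1 / 2)).tendsto _).comp
        (ENNReal.Tendsto.const_mul tendsto_id (Or.inr hK))
    simpa using this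
  refine le_antisymm ?_ bot_le
  refine ge_of_tendsto (hlim.mono_left (nhdsWithin_le_nhds (s := Set.Ioi 0))) ?_
  filter_upwards [self_mem_nhdsWithin] with ε hε
  -- Approximating in `p + q` makes the same cylinder close to `A` under both measures.
  obtain ⟨t, ht, htA⟩ := exists_measure_symmDiff_lt_of_generateFrom_isSetRing (μ := p + q)
    isSetRing_measurableCylinders
    ⟨{Set.univ}, Set.countable_singleton _, by
      simpa using univ_mem_measurableCylinders X, by simp⟩
    generateFrom_measurableCylinders.symm hA hε
  obtain ⟨s, S, hS, rfl⟩ := (mem_measurableCylinders _).1 ht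
  have hle : p (symmDiff (cylinder s S) A) + q (symmDiff (cylinder s S) A) < ε := by
    simpa using htA
  have hq : q (cylinder s S) ≤ ε := by
    calc q (cylinder s S) ≤ q (symmDiff (cylinder s S) A ∪ A) :=
          measure_mono fun x hx => by
            by_cases hxA : x ∈ A
            · exact Or.inr hxA
            · exact Or.inl (Or.inl ⟨hx, hxA⟩)
      _ ≤ q (symmDiff (cylinder s S) A) + q A := measure_union_le _ _
      _ ≤ ε := by rw [hQ, add_zero]; exact (le_add_self.trans hle.le)
  have hp : p (cylinder s S) ≤ (K * ε) ^ (1 / 2 : ℝ) := by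
    have h1 : p (cylinder s S) ^ 2 ≤ K * ε :=
      (infinitePi_cylinder_sq_le hC s hS).trans (mul_le_mul' (hCK s) hq)
    calc p (cylinder s S) = (p (cylinder s S) ^ 2) ^ (1 / 2 : ℝ) := by
          rw [← ENNReal.rpow_natCast, ← ENNReal.rpow_mul]; norm_num
      _ ≤ _ := ENNReal.rpow_le_rpow h1 (by norm_num)
  calc p A ≤ p (cylinder s S ∪ symmDiff (cylinder s S) A) :=
        measure_mono fun x hx => by
          by_cases hxA : x ∈ cylinder s S
          · exact Or.inl hxA
          · exact Or.inr (Or.inr ⟨hx, hxA⟩)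
    _ ≤ p (cylinder s S) + p (symmDiff (cylinder s S) A) := measure_union_le _ _
    _ ≤ _ := add_le_add hp (le_self_add.trans hle.le)

theorem infinitePi_gaussianReal_absolutelyContinuous {ι : Type*} {v : ℝ≥0} (hv : v ≠ 0)
    {f g : ι → ℝ} (h : Summable fun i => (f i - g i) ^ 2) :
    Measure.infinitePi (fun i => gaussianReal (f i) v) ≪
      Measure.infinitePi (fun i => gaussianReal (g i) v) := by
  refine infinitePi_absolutelyContinuous
    (C := fun i => ENNReal.ofReal (Real.exp ((f i - g i) ^ 2 / v)))
    (fun i g' hg' => lintegral_gaussianReal_sq_le hv _ _ hg')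
    (K := ENNReal.ofReal (Real.exp ((∑' i, (f i - g i) ^ 2) / v))) ENNReal.ofReal_ne_top ?_
  intro s
  rw [← ENNReal.ofReal_prod_of_nonneg fun i _ => (Real.exp_pos _).le, ← Real.exp_sum,
    ← Finset.sum_div]
  gcongr
  exact h.sum_le_tsum s fun i _ => sq_nonneg _

end GaussianShift

/-! ### Bayes' formula for a single coefficient, and its transfer to data generated from `f₀`. -/

section CoordinatePosterior

theorem lintegral_prod_infinitePi {ι : Type*} {X : ι → Type*} [∀ i, MeasurableSpace (X i)]
    (μ : ∀ i, Measure (X i)) [∀ i, IsProbabilityMeasure (μ i)] (s : Finset ι)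
    {F : ∀ i, X i → ℝ≥0∞} (hF : ∀ i, Measurable (F i)) :
    ∫⁻ x, ∏ i ∈ s, F i (x i) ∂Measure.infinitePi μ = ∏ i ∈ s, ∫⁻ y, F i y ∂μ i := by
  rw [lintegral_prod_eq_prod_lintegral_of_indepFun s (fun i (x : ∀ i, X i) => F i (x i))
    (iIndepFun_infinitePi hF) (fun i => (hF i).comp (measurable_pi_apply i))]
  refine Finset.prod_congr rfl fun i _ => ?_
  exact (measurePreserving_eval_infinitePi μ i).lintegral_comp (hF i)

/-- The posterior mass of `S` in the Gaussian location model with variance `v` and prior `p`,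
given the observation `x`. -/
noncomputable def coordPosterior (p : Measure ℝ) (v : ℝ≥0) (S : Set ℝ) (x : ℝ) : ℝ≥0∞ :=
  (∫⁻ θ in S, gaussianPDF θ v x ∂p) / ∫⁻ θ, gaussianPDF θ v x ∂p

theorem measurable_gaussianPDF_prod (v : ℝ≥0) :
    Measurable fun q : ℝ × ℝ => gaussianPDF q.1 v q.2 := by
  unfold gaussianPDF gaussianPDFReal; fun_prop

theorem measurable_gaussianPDF_prod_swap (v : ℝ≥0) :
    Measurable fun q : ℝ × ℝ => gaussianPDF q.2 v q.1 := by
  unfold gaussianPDF gaussianPDFReal; fun_prop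

theorem measurable_gaussianPDF_left (v : ℝ≥0) (x : ℝ) :
    Measurable fun θ => gaussianPDF θ v x := by
  unfold gaussianPDF gaussianPDFReal; fun_prop

theorem measurable_coordPosterior (p : Measure ℝ) [SFinite p] (v : ℝ≥0) (S : Set ℝ) :
    Measurable (coordPosterior p v S) := by
  refine Measurable.div ?_ ?_
  · exact (measurable_gaussianPDF_prod_swap v).lintegral_prod_right' (ν := p.restrict S)
  · exact (measurable_gaussianPDF_prod_swap v).lintegral_prod_right' (ν := p)

theorem gaussianPDF_le (v : ℝ≥0) (θ x : ℝ) :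
    gaussianPDF θ v x ≤ ENNReal.ofReal (√(2 * Real.pi * v))⁻¹ := by
  rw [gaussianPDF, gaussianPDFReal]
  refine ENNReal.ofReal_le_ofReal (mul_le_of_le_one_right (by positivity) ?_)
  rw [Real.exp_le_one_iff]
  exact div_nonpos_of_nonpos_of_nonneg (by nlinarith [sq_nonneg (x - θ)]) (by positivity)

theorem lintegral_gaussianPDF_left_ne_top (p : Measure ℝ) [IsFiniteMeasure p] (v : ℝ≥0) (x : ℝ) :
    ∫⁻ θ, gaussianPDF θ v x ∂p ≠ ∞ := by
  refine ne_top_of_le_ne_top ?_ (lintegral_mono fun θ => gaussianPDF_le v θ x)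
  rw [lintegral_const]
  exact ENNReal.mul_ne_top ENNReal.ofReal_ne_top (measure_ne_top _ _)

theorem lintegral_gaussianPDF_left_ne_zero (p : Measure ℝ) [NeZero p] {v : ℝ≥0} (hv : v ≠ 0)
    (x : ℝ) : ∫⁻ θ, gaussianPDF θ v x ∂p ≠ 0 := by
  refine (lintegral_pos_iff_support (measurable_gaussianPDF_left v x)).2 ?_ |>.ne'
  have : Function.support (fun θ => gaussianPDF θ v x) = Set.univ :=
    Set.eq_univ_of_forall fun θ => (gaussianPDF_pos θ hv x).ne'
  rw [this]
  exact Measure.measure_univ_pos.2 (NeZero.ne p)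

theorem coordPosterior_le_one (p : Measure ℝ) (v : ℝ≥0) (S : Set ℝ) (x : ℝ) :
    coordPosterior p v S x ≤ 1 :=
  ENNReal.div_le_of_le_mul (by rw [one_mul]; exact setLIntegral_le_lintegral _ _)

/-- The defining identity of a conditional probability. After Tonelli the normalising integral
cancels, being neither zero nor infinite. -/
theorem lintegral_coordPosterior (p : Measure ℝ) [IsProbabilityMeasure p] {v : ℝ≥0} (hv : v ≠ 0)
    {S T : Set ℝ} (hT : MeasurableSet T) :
    ∫⁻ θ, ∫⁻ x in T, coordPosterior p v S x ∂gaussianReal θ v ∂p =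
      ∫⁻ θ in S, gaussianReal θ v T ∂p := by
  have hm := measurable_coordPosterior p v S
  have h1 : ∀ θ, ∫⁻ x in T, coordPosterior p v S x ∂gaussianReal θ v =
      ∫⁻ x in T, gaussianPDF θ v x * coordPosterior p v S x := by
    intro θ
    rw [gaussianReal_of_var_ne_zero _ hv, restrict_withDensity hT,
      lintegral_withDensity_eq_lintegral_mul _ (measurable_gaussianPDF θ v) hm]
    rfl
  simp_rw [h1, gaussianReal_apply _ hv]
  rw [lintegral_lintegral_swap
      ((measurable_gaussianPDF_prod v).mul (hm.comp measurable_snd)).aemeasurable,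
    lintegral_lintegral_swap (μ := p.restrict S) (measurable_gaussianPDF_prod v).aemeasurable]
  refine lintegral_congr fun x => ?_
  rw [lintegral_mul_const _ (measurable_gaussianPDF_left v x), coordPosterior]
  exact ENNReal.mul_div_cancel (lintegral_gaussianPDF_left_ne_zero p hv x)
    (lintegral_gaussianPDF_left_ne_top p v x)

theorem measurable_lintegral_gaussianReal (v : ℝ≥0) {g : ℝ → ℝ≥0∞} (hg : Measurable g) :
    Measurable fun θ => ∫⁻ x, g x ∂gaussianReal θ v :=
  (Measure.measurable_lintegral hg).comp
    (measurable_gaussianReal.comp (measurable_id.prodMk measurable_const))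

theorem measurable_gaussianReal_apply (v : ℝ≥0) {T : Set ℝ} (hT : MeasurableSet T) :
    Measurable fun θ => gaussianReal θ v T :=
  (Measure.measurable_coe hT).comp
    (measurable_gaussianReal.comp (measurable_id.prodMk measurable_const))

end CoordinatePosterior

namespace BoundaryWavelets

theorem model_apply (B : BoundaryWavelets) (n : ℕ) (f : B.Index → ℝ) :
    B.model n f = Measure.infinitePi (fun i => gaussianReal (f i) ((n : ℝ≥0)⁻¹)) := rfl

/-- Both sides are densities with respect to the marginal law of the data, so it suffices that they
give the same mass to finite boxes. On a box everything factorises over coordinates, and only the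
factor at `i` involves `S`. -/
theorem posterior_eval_ae_eq (B : BoundaryWavelets) (p : B.Index → Measure ℝ)
    [∀ i, IsProbabilityMeasure (p i)] {n : ℕ} (hn : n ≠ 0) (i : B.Index) {S : Set ℝ}
    (hS : MeasurableSet S) :
    (fun X => posterior (B.model n) (Measure.infinitePi p) X {f | f i ∈ S}) =ᵐ[
      B.model n ∘ₘ Measure.infinitePi p]
      fun X => coordPosterior (p i) (n : ℝ≥0)⁻¹ S (X i) := by
  classical
  set v : ℝ≥0 := (n : ℝ≥0)⁻¹ with hv_def
  have hv : v ≠ 0 := by simp [hv_def, hn]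
  set P := Measure.infinitePi p with hP
  have hA : MeasurableSet {f : B.Index → ℝ | f i ∈ S} := measurable_pi_apply i hS
  have hG : Measurable fun X : B.Index → ℝ => coordPosterior (p i) v S (X i) :=
    (measurable_coordPosterior (p i) v S).comp (measurable_pi_apply i)
  have hpost : Measurable fun X => posterior (B.model n) P X {f | f i ∈ S} :=
    Kernel.measurable_coe _ hA
  have hfin : ∫⁻ X, posterior (B.model n) P X {f | f i ∈ S} ∂(B.model n ∘ₘ P) ≠ ∞ := by
    refine ne_top_of_le_ne_top (b := 1) ENNReal.one_ne_top ?_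
    calc _ ≤ ∫⁻ _, 1 ∂(B.model n ∘ₘ P) := lintegral_mono fun X => prob_le_one
      _ = 1 := by simp
  rw [← withDensity_eq_iff hpost.aemeasurable hG.aemeasurable hfin]
  have key1 : ∀ T, MeasurableSet T → (B.model n ∘ₘ P).withDensity
      (fun X => posterior (B.model n) P X {f | f i ∈ S}) T =
      ∫⁻ f, S.indicator 1 (f i) * B.model n f T ∂P := by
    intro T hT
    rw [withDensity_apply _ hT, ← Measure.compProd_apply_prod hT hA,
      compProd_posterior_eq_map_swap, Measure.map_apply measurable_swap (hT.prod hA),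
      Set.preimage_swap_prod, Measure.compProd_apply_prod hA hT, ← lintegral_indicator hA]
    refine lintegral_congr fun f => ?_
    by_cases hf : f i ∈ S <;> simp [Set.indicator, hf]
  have key2 : ∀ T, MeasurableSet T → (B.model n ∘ₘ P).withDensity
      (fun X => coordPosterior (p i) v S (X i)) T =
      ∫⁻ f, ∫⁻ X in T, coordPosterior (p i) v S (X i) ∂B.model n f ∂P := by
    intro T hT
    rw [withDensity_apply _ hT, ← lintegral_indicator hT,
      Measure.lintegral_bind (Kernel.aemeasurable _) (hG.indicator hT).aemeasurable]
    refine lintegral_congr fun f => ?_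
    rw [lintegral_indicator hT]
  have : IsFiniteMeasure ((B.model n ∘ₘ P).withDensity
      (fun X => posterior (B.model n) P X {f | f i ∈ S})) := isFiniteMeasure_withDensity hfin
  have hbox : ∀ (s : Finset B.Index) (t : B.Index → Set ℝ), i ∈ s →
      (∀ j, MeasurableSet (t j)) →
      (B.model n ∘ₘ P).withDensity (fun X => posterior (B.model n) P X {f | f i ∈ S})
        ((s : Set B.Index).pi t) =
      (B.model n ∘ₘ P).withDensity (fun X => coordPosterior (p i) v S (X i))
        ((s : Set B.Index).pi t) := by
    intro s t his ht
    have hT : MeasurableSet ((s : Set B.Index).pi t) :=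
      MeasurableSet.pi s.countable_toSet fun j _ => ht j
    rw [key1 _ hT, key2 _ hT]
    have e1 : ∀ f : B.Index → ℝ, S.indicator 1 (f i) * B.model n f ((s : Set B.Index).pi t) =
        ∏ j ∈ s, (if j = i then S.indicator (1 : ℝ → ℝ≥0∞) (f j) else 1) *
          gaussianReal (f j) v (t j) := by
      intro f
      rw [model_apply, Measure.infinitePi_pi _ fun j _ => ht j, Finset.prod_mul_distrib,
        Finset.prod_ite_eq' s i, if_pos his]
    have e2 : ∀ f : B.Index → ℝ, ∫⁻ X in (s : Set B.Index).pi t,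
        coordPosterior (p i) v S (X i) ∂B.model n f =
        ∏ j ∈ s, ∫⁻ x, (t j).indicator
          (fun x => if j = i then coordPosterior (p i) v S x else 1) x ∂gaussianReal (f j) v := by
      intro f
      rw [model_apply, ← lintegral_indicator hT, ← lintegral_prod_infinitePi]
      · refine lintegral_congr fun X => ?_
        by_cases hX : X ∈ (s : Set B.Index).pi t
        · rw [Set.indicator_of_mem hX, Finset.prod_congr rfl fun j hj =>
            Set.indicator_of_mem (hX j hj) _, Finset.prod_ite_eq' s i, if_pos his]
        · rw [Set.indicator_of_notMem hX]
          simp only [Set.mem_pi, not_forall] at hX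
          obtain ⟨j, hj, hXj⟩ := hX
          exact (Finset.prod_eq_zero hj (Set.indicator_of_notMem hXj _)).symm
      · intro j
        refine Measurable.indicator ?_ (ht j)
        split_ifs
        · exact measurable_coordPosterior _ _ _
        · exact measurable_const
    simp_rw [e1, e2]
    have hS1 : Measurable (S.indicator (1 : ℝ → ℝ≥0∞)) := measurable_one.indicator hS
    rw [hP, lintegral_prod_infinitePi p s (F := fun j θ =>
        (if j = i then S.indicator (1 : ℝ → ℝ≥0∞) θ else 1) * gaussianReal θ v (t j)),
      lintegral_prod_infinitePi p s (F := fun j θ => ∫⁻ x, (t j).indicator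
          (fun x => if j = i then coordPosterior (p i) v S x else 1) x ∂gaussianReal θ v)]
    · refine Finset.prod_congr rfl fun j _ => ?_
      simp_rw [lintegral_indicator (ht j)]
      split_ifs with hj
      · subst hj
        rw [lintegral_coordPosterior (p j) hv (ht j), ← lintegral_indicator hS]
        refine lintegral_congr fun θ => ?_
        by_cases hθ : θ ∈ S <;> simp [hθ]
      · simp
    · intro j
      refine measurable_lintegral_gaussianReal v (Measurable.indicator ?_ (ht j))
      split_ifs
      · exact measurable_coordPosterior _ _ _
      · exact measurable_const
    · intro j
      refine Measurable.mul ?_ (measurable_gaussianReal_apply v (ht j))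
      split_ifs
      · exact hS1
      · exact measurable_const
  refine ext_of_generate_finite _ generateFrom_squareCylinders.symm
    (isPiSystem_squareCylinders (fun _ => MeasurableSpace.isPiSystem_measurableSet) (by simp))
    ?_ ?_
  · rintro _ ⟨s, t, ht, rfl⟩
    simp only [Set.mem_univ_pi, Set.mem_ofPred_eq] at ht
    -- The factorisation needs `i` among the coordinates of the box, so a trivial side is added if
    -- necessary.
    have : (s : Set B.Index).pi t = ((insert i s : Finset B.Index) : Set B.Index).pi
        (fun j => if j ∈ s then t j else Set.univ) := by
      ext X
      simp only [Set.mem_pi, Finset.mem_coe, Finset.mem_insert]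
      constructor
      · intro hX j _
        split_ifs with hjs
        · exact hX j hjs
        · trivial
      · intro hX j hj
        simpa [hj] using hX j (Or.inr hj)
    rw [this]
    refine hbox _ _ (Finset.mem_insert_self _ _) fun j => ?_
    split_ifs
    · exact ht j
    · exact MeasurableSet.univ
  · simpa using hbox {i} (fun _ => Set.univ) (Finset.mem_singleton_self i)
      fun _ => MeasurableSet.univ

theorem lintegral_posterior_eval (B : BoundaryWavelets) (p : B.Index → Measure ℝ)
    [∀ i, IsProbabilityMeasure (p i)] {n : ℕ} (hn : n ≠ 0) {f₀ : B.Index → ℝ}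
    (hf₀ : ∀ᵐ f ∂Measure.infinitePi p, Summable fun i => (f₀ i - f i) ^ 2)
    (i : B.Index) {S : Set ℝ} (hS : MeasurableSet S) :
    ∫⁻ X, posterior (B.model n) (Measure.infinitePi p) X {f | f i ∈ S} ∂B.model n f₀ =
      ∫⁻ x, coordPosterior (p i) (n : ℝ≥0)⁻¹ S x ∂gaussianReal (f₀ i) (n : ℝ≥0)⁻¹ := by
  have hv : ((n : ℝ≥0)⁻¹) ≠ 0 := by simp [hn]
  have hac : B.model n f₀ ≪ B.model n ∘ₘ Measure.infinitePi p := by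
    refine Measure.AbsolutelyContinuous.mk fun A hA h0 => ?_
    rw [Measure.bind_apply hA (Kernel.aemeasurable _),
      lintegral_eq_zero_iff (Kernel.measurable_coe _ hA)] at h0
    -- A null set of the marginal law is null for the model at almost every `f`; one such `f` at
    -- square summable distance from `f₀` is enough.
    obtain ⟨f, h1, h2⟩ := (h0.and hf₀).exists
    exact infinitePi_gaussianReal_absolutelyContinuous hv h2 h1
  rw [lintegral_congr_ae (hac.ae_le (B.posterior_eval_ae_eq p hn i hS)), model_apply]
  exact (measurePreserving_eval_infinitePi (fun i => gaussianReal (f₀ i) _) i).lintegral_comp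
    (measurable_coordPosterior (p i) _ S)

end BoundaryWavelets

/-! ### Bounds on the posterior of a single coefficient. -/

section CoordinateBounds

theorem gaussianReal_abs_sub_gt_le {v : ℝ≥0} (hv : v ≠ 0) (θ : ℝ) {M : ℝ} (hM : 0 ≤ M) :
    gaussianReal θ v {x | M < |x - θ|} ≤ ENNReal.ofReal (2 * Real.exp (-M ^ 2 / (2 * v))) := by
  have hv' : (0 : ℝ) < v := by positivity
  have h1 := measure_ge_le_exp_mul_mgf (μ := gaussianReal θ v) (X := id) (θ + M)
    (t := M / v) (by positivity) (integrable_exp_mul_gaussianReal _)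
  have h2 := measure_le_le_exp_mul_mgf (μ := gaussianReal θ v) (X := id) (θ - M)
    (t := -(M / v)) (by simp; positivity) (integrable_exp_mul_gaussianReal _)
  rw [mgf_id_gaussianReal, ← Real.exp_add] at h1 h2
  have e1 : -(M / v) * (θ + M) + (θ * (M / v) + v * (M / v) ^ 2 / 2) = -M ^ 2 / (2 * v) := by
    field_simp; ring
  have e2 : -(-(M / v)) * (θ - M) + (θ * -(M / v) + v * (-(M / v)) ^ 2 / 2) =
      -M ^ 2 / (2 * v) := by
    field_simp; ring
  rw [e1] at h1
  rw [e2] at h2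
  rw [← ofReal_measureReal (by finiteness)]
  refine ENNReal.ofReal_le_ofReal ?_
  calc (gaussianReal θ v).real {x | M < |x - θ|}
      ≤ (gaussianReal θ v).real ({x | θ + M ≤ id x} ∪ {x | id x ≤ θ - M}) := by
        refine measureReal_mono fun x hx => ?_
        rcases lt_abs.1 (show M < |x - θ| from hx) with h | h
        · exact Or.inl (show θ + M ≤ x by linarith)
        · exact Or.inr (show x ≤ θ - M by linarith)
    _ ≤ _ := measureReal_union_le _ _
    _ ≤ _ := by linarith

theorem gaussianPDFReal_le_of_le_abs {v : ℝ≥0} {θ x M : ℝ} (hM : 0 ≤ M) (h : M ≤ |x - θ|) :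
    gaussianPDFReal θ v x ≤ (√(2 * Real.pi * v))⁻¹ * Real.exp (-M ^ 2 / (2 * v)) := by
  rw [gaussianPDFReal, ← sq_abs (x - θ)]
  gcongr

theorem le_gaussianPDFReal_of_abs_le {v : ℝ≥0} {θ x r : ℝ} (h : |x - θ| ≤ r) :
    (√(2 * Real.pi * v))⁻¹ * Real.exp (-r ^ 2 / (2 * v)) ≤ gaussianPDFReal θ v x := by
  rw [gaussianPDFReal, ← sq_abs (x - θ)]
  gcongr

/-- The likelihood is small on `S`, and the evidence is at least the contribution of the ball of one
standard deviation around `x`, where the Gaussian factor is at least `exp(-1/2)`. -/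
theorem coordPosterior_le_of_ball (p : Measure ℝ) [IsProbabilityMeasure p] {v : ℝ≥0}
    (hv : v ≠ 0) {S : Set ℝ} {x M c : ℝ} (hM : 0 ≤ M) (hc : 0 < c)
    (hSM : MeasurableSet S) (hS : ∀ θ ∈ S, M ≤ |x - θ|)
    (hp : ENNReal.ofReal c ≤ p {θ | |x - θ| ≤ √v}) :
    coordPosterior p v S x ≤ ENNReal.ofReal (Real.exp (1 / 2 - M ^ 2 / (2 * v)) / c) := by
  have hv' : (0 : ℝ) < v := by positivity
  set K := (√(2 * Real.pi * v))⁻¹ with hK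
  have hKpos : 0 < K := by positivity
  have hnum : ∫⁻ θ in S, gaussianPDF θ v x ∂p ≤
      ENNReal.ofReal (K * Real.exp (-M ^ 2 / (2 * v))) := by
    calc _ ≤ ∫⁻ θ in S, ENNReal.ofReal (K * Real.exp (-M ^ 2 / (2 * v))) ∂p :=
          setLIntegral_mono' hSM fun θ hθ =>
            ENNReal.ofReal_le_ofReal (gaussianPDFReal_le_of_le_abs hM (hS θ hθ))
      _ ≤ _ := by
          rw [setLIntegral_const]
          exact mul_le_of_le_one_right' prob_le_one
  have hB : MeasurableSet {θ : ℝ | |x - θ| ≤ √v} :=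
    measurableSet_le (by fun_prop) measurable_const
  have hden : ENNReal.ofReal (K * Real.exp (-(1 / 2)) * c) ≤ ∫⁻ θ, gaussianPDF θ v x ∂p := by
    calc _ = ENNReal.ofReal (K * Real.exp (-(1 / 2))) * ENNReal.ofReal c :=
          ENNReal.ofReal_mul (by positivity)
      _ ≤ ENNReal.ofReal (K * Real.exp (-(1 / 2))) * p {θ | |x - θ| ≤ √v} := by gcongr
      _ = ∫⁻ θ in {θ | |x - θ| ≤ √v}, ENNReal.ofReal (K * Real.exp (-(1 / 2))) ∂p :=
          (setLIntegral_const _ _).symm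
      _ ≤ ∫⁻ θ in {θ | |x - θ| ≤ √v}, gaussianPDF θ v x ∂p := by
          refine setLIntegral_mono' hB fun θ hθ => ENNReal.ofReal_le_ofReal ?_
          refine le_trans (le_of_eq ?_) (le_gaussianPDFReal_of_abs_le (v := v) (r := √v) hθ)
          rw [Real.sq_sqrt hv'.le]
          congr 2
          field_simp
      _ ≤ _ := setLIntegral_le_lintegral _ _
  calc coordPosterior p v S x ≤ ENNReal.ofReal (K * Real.exp (-M ^ 2 / (2 * v))) /
        ENNReal.ofReal (K * Real.exp (-(1 / 2)) * c) := ENNReal.div_le_div hnum hden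
    _ = _ := by
        rw [← ENNReal.ofReal_div_of_pos (by positivity)]
        congr 1
        rw [mul_assoc, mul_div_mul_left _ _ hKpos.ne', ← div_div, ← Real.exp_sub]
        congr 2
        ring

/-- When the noise is at most `M`, parameters further than `2 * M` from the truth are at least `M`
from the observation; larger noise is a Gaussian tail event. -/
theorem lintegral_coordPosterior_le_of_prior_ball (p : Measure ℝ) [IsProbabilityMeasure p]
    {v : ℝ≥0} (hv : v ≠ 0) {θ₀ M c : ℝ} (hM : 0 ≤ M) (hc : 0 < c)
    (hp : ∀ x, |x - θ₀| ≤ M → ENNReal.ofReal c ≤ p {θ | |x - θ| ≤ √v}) :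
    ∫⁻ x, coordPosterior p v {θ | 2 * M < |θ - θ₀|} x ∂gaussianReal θ₀ v ≤
      ENNReal.ofReal (2 * Real.exp (-M ^ 2 / (2 * v)) +
        Real.exp (1 / 2 - M ^ 2 / (2 * v)) / c) := by
  set S := {θ | 2 * M < |θ - θ₀|}
  have hS : MeasurableSet S := measurableSet_lt measurable_const (by fun_prop)
  set E := {x : ℝ | M < |x - θ₀|}
  have hE : MeasurableSet E := measurableSet_lt measurable_const (by fun_prop)
  rw [ENNReal.ofReal_add (by positivity) (by positivity),
    ← lintegral_add_compl _ hE]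
  refine add_le_add ?_ ?_
  · calc _ ≤ ∫⁻ x in E, 1 ∂gaussianReal θ₀ v :=
          lintegral_mono fun x => coordPosterior_le_one _ _ _ _
      _ = gaussianReal θ₀ v E := setLIntegral_one _
      _ ≤ _ := gaussianReal_abs_sub_gt_le hv _ hM
  · calc _ ≤ ∫⁻ x in Eᶜ, ENNReal.ofReal (Real.exp (1 / 2 - M ^ 2 / (2 * v)) / c)
            ∂gaussianReal θ₀ v := by
          refine setLIntegral_mono' hE.compl fun x hx => ?_
          have hx' : |x - θ₀| ≤ M := le_of_not_gt hx
          refine coordPosterior_le_of_ball p hv hM hc hS (fun θ hθ => ?_) (hp x hx')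
          have h1 : 2 * M < |θ - θ₀| := hθ
          have h2 := abs_sub_le θ x θ₀
          rw [abs_sub_comm x θ]
          linarith
      _ ≤ _ := by
          rw [setLIntegral_const]
          exact mul_le_of_le_one_right' prob_le_one

theorem coordPosterior_eq_ratio (p : Measure ℝ) {v : ℝ≥0} (hv : v ≠ 0) (S : Set ℝ) (x : ℝ) :
    coordPosterior p v S x =
      (∫⁻ θ in S, gaussianRatio v 0 θ x ∂p) / ∫⁻ θ, gaussianRatio v 0 θ x ∂p := by
  have hm : Measurable fun θ => gaussianRatio v 0 θ x := by unfold gaussianRatio; fun_prop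
  have he : (fun θ => gaussianPDF θ v x) = fun θ => gaussianPDF 0 v x * gaussianRatio v 0 θ x :=
    funext fun θ => gaussianPDF_eq_mul_gaussianRatio hv 0 θ x
  rw [coordPosterior, he, lintegral_const_mul _ hm, lintegral_const_mul _ hm,
    ENNReal.mul_div_mul_left _ _ (gaussianPDF_pos 0 hv x).ne' gaussianPDF_ne_top]

/-- Averaging over `θ` and `-θ` replaces `exp(θ x / v)` by `cosh(θ x / v) ≥ 1`, which gives a lower
bound for the evidence free of `x`. -/
theorem le_lintegral_gaussianRatio (p : Measure ℝ) (hp : p.map (fun x => -x) = p) (v : ℝ≥0)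
    (x : ℝ) :
    ∫⁻ θ, ENNReal.ofReal (Real.exp (-θ ^ 2 / (2 * v))) ∂p ≤
      ∫⁻ θ, gaussianRatio v 0 θ x ∂p := by
  have hm : Measurable fun θ => gaussianRatio v 0 θ x := by unfold gaussianRatio; fun_prop
  have hneg : ∫⁻ θ, gaussianRatio v 0 (-θ) x ∂p = ∫⁻ θ, gaussianRatio v 0 θ x ∂p := by
    conv_rhs => rw [← hp, lintegral_map hm measurable_neg]
  have h2 : 2 * ∫⁻ θ, ENNReal.ofReal (Real.exp (-θ ^ 2 / (2 * v))) ∂p ≤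
      2 * ∫⁻ θ, gaussianRatio v 0 θ x ∂p := by
    rw [two_mul (∫⁻ θ, gaussianRatio v 0 θ x ∂p)]
    nth_rewrite 2 [← hneg]
    rw [← lintegral_add_left hm, ← lintegral_const_mul _ (by fun_prop)]
    refine lintegral_mono fun θ => ?_
    simp only [gaussianRatio]
    rw [← ENNReal.ofReal_add (Real.exp_pos _).le (Real.exp_pos _).le,
      show (2 : ℝ≥0∞) = ENNReal.ofReal 2 by simp, ← ENNReal.ofReal_mul (by norm_num)]
    refine ENNReal.ofReal_le_ofReal ?_
    have e1 : ((θ - 0) * x - (θ ^ 2 - 0 ^ 2) / 2) / v = -θ ^ 2 / (2 * v) + θ * x / v := by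
      rw [mul_comm 2 (v : ℝ), ← div_div]; ring
    have e2 : ((-θ - 0) * x - ((-θ) ^ 2 - 0 ^ 2) / 2) / v = -θ ^ 2 / (2 * v) + -(θ * x / v) := by
      rw [mul_comm 2 (v : ℝ), ← div_div]; ring
    rw [e1, e2, Real.exp_add, Real.exp_add, ← mul_add, mul_comm]
    gcongr
    have := Real.one_le_cosh (θ * x / v)
    rw [Real.cosh_eq] at this
    linarith
  exact (ENNReal.mul_le_mul_iff_right (by norm_num) (by norm_num)).1 h2

/-- The bound must be uniform in `θ`, since a heavy-tailed prior need not integrate the full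
expectation `exp(θ₀ θ / v)`. Truncating `x` achieves this: for `|θ| ≥ 2 * b` the ratio is at most
one on the window, and for smaller `|θ|` the full expectation is harmless. -/
theorem setLIntegral_gaussianRatio_le {v : ℝ≥0} (hv : v ≠ 0) (θ₀ θ : ℝ) {b : ℝ} (hb : 0 ≤ b) :
    ∫⁻ x in {x | |x| ≤ b}, gaussianRatio v 0 θ x ∂gaussianReal θ₀ v ≤
      ENNReal.ofReal (Real.exp (2 * b * |θ₀| / v)) := by
  have hv' : (0 : ℝ) < v := by positivity
  have hB : MeasurableSet {x : ℝ | |x| ≤ b} := measurableSet_le (by fun_prop) measurable_const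
  rcases le_total (2 * b) |θ| with hθ | hθ
  · calc _ ≤ ∫⁻ x in {x | |x| ≤ b}, 1 ∂gaussianReal θ₀ v := by
          refine setLIntegral_mono' hB fun x hx => ?_
          rw [gaussianRatio, ENNReal.ofReal_le_one, Real.exp_le_one_iff]
          refine div_nonpos_of_nonpos_of_nonneg ?_ hv'.le
          have h1 : θ * x ≤ |θ| * b := by
            calc θ * x ≤ |θ * x| := le_abs_self _
              _ = |θ| * |x| := abs_mul _ _
              _ ≤ _ := by gcongr; exact hx
          have h2 : θ ^ 2 = |θ| ^ 2 := (sq_abs θ).symm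
          nlinarith [abs_nonneg θ]
      _ ≤ 1 := by rw [setLIntegral_one]; exact prob_le_one
      _ ≤ _ := by
          rw [ENNReal.one_le_ofReal]
          exact Real.one_le_exp (by positivity)
  · have h : ∀ x, gaussianRatio v 0 θ x = ENNReal.ofReal (Real.exp (-θ ^ 2 / (2 * v))) *
        ENNReal.ofReal (Real.exp (θ / v * x)) := by
      intro x
      rw [gaussianRatio, ← ENNReal.ofReal_mul (Real.exp_pos _).le, ← Real.exp_add]
      congr 2
      field_simp
      ring
    calc _ ≤ ∫⁻ x, gaussianRatio v 0 θ x ∂gaussianReal θ₀ v := setLIntegral_le_lintegral _ _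
      _ = ENNReal.ofReal (Real.exp (θ₀ * θ / v)) := by
          simp_rw [h]
          rw [lintegral_const_mul _ (by fun_prop), lintegral_exp_mul_gaussianReal,
            ← ENNReal.ofReal_mul (Real.exp_pos _).le, ← Real.exp_add]
          congr 2
          field_simp
          ring
      _ ≤ _ := by
          refine ENNReal.ofReal_le_ofReal (Real.exp_le_exp.2
            (div_le_div_of_nonneg_right ?_ hv'.le))
          calc θ₀ * θ ≤ |θ₀ * θ| := le_abs_self _
            _ = |θ| * |θ₀| := by rw [abs_mul, mul_comm]
            _ ≤ _ := by gcongr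

/-- For a signal below the noise level the data hardly move the prior: the evidence is bounded below
by symmetry, and the numerator is averaged over `x` before `θ`. Observations further than `a` from
`θ₀` are discarded at the cost of a Gaussian tail. -/
theorem lintegral_coordPosterior_le_of_symmetric (p : Measure ℝ) [IsProbabilityMeasure p]
    (hp : p.map (fun x => -x) = p) {v : ℝ≥0} (hv : v ≠ 0) {θ₀ a c : ℝ} (ha : 0 ≤ a) (hc : 0 < c)
    (hcp : ENNReal.ofReal c ≤ ∫⁻ θ, ENNReal.ofReal (Real.exp (-θ ^ 2 / (2 * v))) ∂p)
    {S : Set ℝ} :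
    ∫⁻ x, coordPosterior p v S x ∂gaussianReal θ₀ v ≤
      ENNReal.ofReal (2 * Real.exp (-a ^ 2 / (2 * v))) +
        ENNReal.ofReal (Real.exp (2 * (|θ₀| + a) * |θ₀| / v) / c) * p S := by
  set b := |θ₀| + a with hb
  have hb0 : 0 ≤ b := by positivity
  set E := {x : ℝ | |x| ≤ b}
  have hE : MeasurableSet E := measurableSet_le (by fun_prop) measurable_const
  have hm : Measurable fun q : ℝ × ℝ => gaussianRatio v 0 q.2 q.1 := by
    unfold gaussianRatio; fun_prop
  rw [← lintegral_add_compl _ hE, add_comm]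
  refine add_le_add ?_ ?_
  · calc _ ≤ ∫⁻ x in Eᶜ, 1 ∂gaussianReal θ₀ v :=
          lintegral_mono fun x => coordPosterior_le_one _ _ _ _
      _ = gaussianReal θ₀ v Eᶜ := setLIntegral_one _
      _ ≤ gaussianReal θ₀ v {x | a < |x - θ₀|} := measure_mono fun x hx => by
          have h1 : b < |x| := not_le.1 hx
          have h2 : |x| ≤ |x - θ₀| + |θ₀| := by simpa using abs_add_le (x - θ₀) θ₀
          change a < |x - θ₀|
          linarith
      _ ≤ _ := gaussianReal_abs_sub_gt_le hv _ ha
  · calc _ ≤ ∫⁻ x in E, (∫⁻ θ in S, gaussianRatio v 0 θ x ∂p) * (ENNReal.ofReal c)⁻¹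
            ∂gaussianReal θ₀ v := by
          refine lintegral_mono fun x => ?_
          rw [coordPosterior_eq_ratio p hv, div_eq_mul_inv]
          gcongr
          exact hcp.trans (le_lintegral_gaussianRatio p hp v x)
      _ = (∫⁻ x in E, ∫⁻ θ in S, gaussianRatio v 0 θ x ∂p ∂gaussianReal θ₀ v) *
            (ENNReal.ofReal c)⁻¹ :=
          lintegral_mul_const' _ _ (by simp [hc])
      _ = (∫⁻ θ in S, ∫⁻ x in E, gaussianRatio v 0 θ x ∂gaussianReal θ₀ v ∂p) *
            (ENNReal.ofReal c)⁻¹ := by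
          rw [lintegral_lintegral_swap hm.aemeasurable]
      _ ≤ (∫⁻ θ in S, ENNReal.ofReal (Real.exp (2 * b * |θ₀| / v)) ∂p) *
            (ENNReal.ofReal c)⁻¹ := by
          gcongr with θ
          exact setLIntegral_gaussianRatio_le hv θ₀ θ hb0
      _ = _ := by
          rw [setLIntegral_const, ENNReal.ofReal_div_of_pos hc]
          simp only [div_eq_mul_inv]
          ring

end CoordinateBounds

/-! ### From wavelet coefficients to the supremum norm. -/

theorem exists_sum_translates_le {φ : ℝ → ℝ} {C : ℝ} (hC : ∀ x, |φ x| ≤ C)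
    (hφ : HasCompactSupport φ) :
    ∃ D : ℝ, 0 ≤ D ∧ ∀ (s : Finset ℕ) (y : ℝ), ∑ k ∈ s, |φ (y - k)| ≤ D := by
  obtain ⟨R, hR⟩ := hφ.isCompact.isBounded.subset_closedBall 0
  have hC0 : 0 ≤ C := (abs_nonneg _).trans (hC 0)
  have hsupp : ∀ x, R < |x| → φ x = 0 := by
    intro x hx
    by_contra h
    have := hR (subset_tsupport φ h)
    rw [mem_closedBall_zero_iff, Real.norm_eq_abs] at this
    linarith
  -- At most `2 * |R| + 1` integers lie within distance `|R|` of `y`; the absolute value covers an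
  -- empty support, where `R` may be negative.
  refine ⟨(2 * |R| + 1) * C, by positivity, fun s y => ?_⟩
  classical
  have h1 : ∑ k ∈ s, |φ (y - k)| ≤ ∑ k ∈ s.filter (fun k : ℕ => |y - (k : ℝ)| ≤ R), C := by
    rw [Finset.sum_filter]
    refine Finset.sum_le_sum fun k _ => ?_
    split_ifs with h
    · exact hC _
    · rw [hsupp _ (not_le.1 h), abs_zero]
  refine h1.trans ?_
  rw [Finset.sum_const, nsmul_eq_mul]
  gcongr
  have h2 : (s.filter fun k : ℕ => |y - (k : ℝ)| ≤ R).card ≤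
      (Finset.Icc ⌈y - |R|⌉ ⌊y + |R|⌋).card := by
    refine Finset.card_le_card_of_injOn (fun k : ℕ => (k : ℤ)) (fun k hk => ?_)
      (fun a _ b _ h => by simpa using h)
    simp only [Finset.coe_filter, Set.mem_ofPred_eq] at hk
    have h3 := abs_le.1 (hk.2.trans (le_abs_self R))
    simp only [Finset.coe_Icc, Set.mem_Icc]
    exact ⟨Int.ceil_le.2 (by push_cast; linarith), Int.le_floor.2 (by push_cast; linarith)⟩
  calc ((s.filter fun k : ℕ => |y - (k : ℝ)| ≤ R).card : ℝ)
      ≤ ((⌊y + |R|⌋ + 1 - ⌈y - |R|⌉).toNat : ℝ) := by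
        rw [Int.card_Icc] at h2; exact_mod_cast h2
    _ = (((⌊y + |R|⌋ + 1 - ⌈y - |R|⌉).toNat : ℤ) : ℝ) := (Int.cast_natCast _).symm
    _ = ((max (⌊y + |R|⌋ + 1 - ⌈y - |R|⌉) 0 : ℤ) : ℝ) := by rw [Int.ofNat_toNat]
    _ ≤ 2 * |R| + 1 := by
        push_cast
        refine max_le ?_ (by positivity)
        linarith [Int.floor_le (y + |R|), Int.le_ceil (y - |R|)]

namespace BoundaryWavelets

variable (B : BoundaryWavelets)

theorem exists_card_le : ∃ C : ℝ, 0 < C ∧ ∀ l, (B.card l : ℝ) ≤ C * 2 ^ l := by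
  refine ⟨∑ l ∈ Finset.range B.J, (B.coarseCard l : ℝ) + 1, by positivity, fun l => ?_⟩
  have h1 : (1 : ℝ) ≤ 2 ^ l := one_le_pow₀ (by norm_num)
  rw [card]
  split_ifs with hl
  · have h2 : (B.coarseCard l : ℝ) ≤ ∑ l ∈ Finset.range B.J, (B.coarseCard l : ℝ) :=
      Finset.single_le_sum (f := fun l => (B.coarseCard l : ℝ)) (fun _ _ => by positivity)
        (Finset.mem_range.2 hl)
    nlinarith
  · have h2 : (0 : ℝ) ≤ ∑ l ∈ Finset.range B.J, (B.coarseCard l : ℝ) := by positivity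
    push_cast
    nlinarith

theorem measurable_psi (i : B.Index) : Measurable (B.psi i) := by
  unfold psi
  dsimp only
  split_ifs
  · exact B.measurable_coarse _ _
  · exact ((B.measurable_left _).comp (by fun_prop)).const_mul _
  · exact ((B.measurable_right _).comp (by fun_prop)).const_mul _
  · exact (B.measurable_mother.comp (by fun_prop)).const_mul _

theorem exists_sum_abs_psi_le : ∃ C : ℝ, 0 ≤ C ∧ ∀ l x,
    ∑ k : Fin (B.card l), |B.psi ⟨l, k⟩ x| ≤ C * (2 : ℝ) ^ ((l : ℝ) / 2) := by
  choose Cc hCc using B.bounded_coarse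
  choose Cl hCl using B.bounded_left
  choose Cr hCr using B.bounded_right
  obtain ⟨Cm, hCm⟩ := B.bounded_mother
  obtain ⟨D, hD0, hD⟩ := exists_sum_translates_le hCm B.hasCompactSupport_mother
  have hCc0 : ∀ l k, 0 ≤ Cc l k := fun l k => (abs_nonneg _).trans (hCc l k 0)
  have hCl0 : ∀ k, 0 ≤ Cl k := fun k => (abs_nonneg _).trans (hCl k 0)
  have hCr0 : ∀ k, 0 ≤ Cr k := fun k => (abs_nonneg _).trans (hCr k 0)
  set A := ∑ l ∈ Finset.range B.J, ∑ k ∈ Finset.range (B.coarseCard l), Cc l k with hA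
  set El := ∑ k ∈ Finset.range B.N, Cl k with hEl
  set Er := ∑ k ∈ Finset.range B.N, Cr k with hEr
  have hA0 : 0 ≤ A := Finset.sum_nonneg fun l _ => Finset.sum_nonneg fun k _ => hCc0 l k
  have hEl0 : 0 ≤ El := Finset.sum_nonneg fun k _ => hCl0 k
  have hEr0 : 0 ≤ Er := Finset.sum_nonneg fun k _ => hCr0 k
  refine ⟨A + (El + Er + D), by positivity, fun l x => ?_⟩
  have hpow : (1 : ℝ) ≤ (2 : ℝ) ^ ((l : ℝ) / 2) :=
    Real.one_le_rpow (by norm_num) (by positivity)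
  by_cases hl : l < B.J
  · have hcard : B.card l = B.coarseCard l := by rw [card, if_pos hl]
    calc ∑ k : Fin (B.card l), |B.psi ⟨l, k⟩ x|
        ≤ ∑ k : Fin (B.card l), Cc l k := Finset.sum_le_sum fun k _ => by
          simp only [psi, if_pos hl]; exact hCc l k x
      _ = ∑ k ∈ Finset.range (B.coarseCard l), Cc l k := by
          rw [Fin.sum_univ_eq_sum_range (fun k => Cc l k), hcard]
      _ ≤ A := Finset.single_le_sum
          (f := fun l => ∑ k ∈ Finset.range (B.coarseCard l), Cc l k)
          (fun l _ => Finset.sum_nonneg fun k _ => hCc0 l k) (Finset.mem_range.2 hl)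
      _ ≤ (A + (El + Er + D)) * 1 := by linarith
      _ ≤ _ := by gcongr
  · have hcard : B.card l = 2 ^ l := by rw [card, if_neg hl]
    have hterm : ∀ k : Fin (B.card l), |B.psi ⟨l, k⟩ x| ≤ (2 : ℝ) ^ ((l : ℝ) / 2) *
        ((if (k : ℕ) < B.N then Cl k else 0) +
          (if 2 ^ l - 1 - (k : ℕ) < B.N then Cr (2 ^ l - 1 - k) else 0) +
          |B.mother ((2 : ℝ) ^ l * x - (k : ℕ))|) := by
      intro k
      have hk : (k : ℕ) < 2 ^ l := hcard ▸ k.2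
      have i1 : 0 ≤ (if (k : ℕ) < B.N then Cl k else 0) := by
        split_ifs
        · exact hCl0 _
        · exact le_rfl
      have i2 : 0 ≤ (if 2 ^ l - 1 - (k : ℕ) < B.N then Cr (2 ^ l - 1 - k) else 0) := by
        split_ifs
        · exact hCr0 _
        · exact le_rfl
      have i3 := abs_nonneg (B.mother ((2 : ℝ) ^ l * x - (k : ℕ)))
      simp only [psi, if_neg hl]
      rw [abs_mul, abs_of_pos (show (0 : ℝ) < (2 : ℝ) ^ ((l : ℝ) / 2) by positivity)]
      gcongr
      by_cases h1 : (k : ℕ) < B.N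
      · rw [if_pos h1, if_pos h1]
        have := hCl k ((2 : ℝ) ^ l * x)
        linarith
      · rw [if_neg h1]
        by_cases h2 : 2 ^ l ≤ (k : ℕ) + B.N
        · have h3 : 2 ^ l - 1 - (k : ℕ) < B.N := by omega
          rw [if_pos h2, if_pos h3]
          have := hCr (2 ^ l - 1 - k) ((2 : ℝ) ^ l * (x - 1))
          linarith
        · rw [if_neg h2]
          linarith
    have hsub : ∀ (m : ℕ) (c : ℕ → ℝ), (∀ k, 0 ≤ c k) →
        ∑ k ∈ Finset.range m, (if k < B.N then c k else 0) ≤ ∑ k ∈ Finset.range B.N, c k := by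
      intro m c hc
      rw [← Finset.sum_filter]
      refine Finset.sum_le_sum_of_subset_of_nonneg (fun k hk => ?_) fun k _ _ => hc k
      exact Finset.mem_range.2 (Finset.mem_filter.1 hk).2
    calc ∑ k : Fin (B.card l), |B.psi ⟨l, k⟩ x| ≤ _ := Finset.sum_le_sum fun k _ => hterm k
      _ = (2 : ℝ) ^ ((l : ℝ) / 2) *
          (∑ k ∈ Finset.range (2 ^ l), (if k < B.N then Cl k else 0) +
          ∑ k ∈ Finset.range (2 ^ l), (if 2 ^ l - 1 - k < B.N then Cr (2 ^ l - 1 - k) else 0) +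
          ∑ k ∈ Finset.range (2 ^ l), |B.mother ((2 : ℝ) ^ l * x - (k : ℕ))|) := by
          rw [← Finset.mul_sum, Fin.sum_univ_eq_sum_range (fun k =>
            (if k < B.N then Cl k else 0) +
            (if 2 ^ l - 1 - k < B.N then Cr (2 ^ l - 1 - k) else 0) +
            |B.mother ((2 : ℝ) ^ l * x - (k : ℕ))|), hcard, Finset.sum_add_distrib,
            Finset.sum_add_distrib]
      _ ≤ (2 : ℝ) ^ ((l : ℝ) / 2) * (El + Er + D) := by
          gcongr
          · exact hsub _ _ hCl0
          · rw [Finset.sum_range_reflect (fun k => if k < B.N then Cr k else 0)]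
            exact hsub _ _ hCr0
          · exact hD _ _
      _ ≤ _ := by
          rw [mul_comm]
          exact mul_le_mul_of_nonneg_right (by linarith) (by positivity)

variable {B}

theorem isProbabilityMeasure_unitMeasure : IsProbabilityMeasure unitMeasure :=
  ⟨by simp [unitMeasure]⟩

/-- Since `supNorm` is an infimum, one function with coefficients `g` suffices. The wavelet series,
summed level by level, converges uniformly, and dominated convergence with orthonormality identifies
its coefficients. -/
theorem exists_supNorm_le (hB : B.IsOrthonormalBasis) : ∃ C : ℝ, 0 ≤ C ∧
    ∀ (g : B.Index → ℝ) (u : ℕ → ℝ), (∀ l, 0 ≤ u l) → (∀ i, |g i| ≤ u i.1) →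
      Summable (fun l : ℕ => (2 : ℝ) ^ ((l : ℝ) / 2) * u l) →
      B.supNorm g ≤ ENNReal.ofReal (C * ∑' l : ℕ, (2 : ℝ) ^ ((l : ℝ) / 2) * u l) := by
  obtain ⟨C, hC0, hC⟩ := B.exists_sum_abs_psi_le
  refine ⟨C, hC0, fun g u hu0 hgu hu => ?_⟩
  have := isProbabilityMeasure_unitMeasure
  set w : ℕ → ℝ := fun l => C * ((2 : ℝ) ^ ((l : ℝ) / 2) * u l) with hw
  have hws : Summable w := hu.mul_left C
  set T : ℕ → ℝ → ℝ := fun l x => ∑ k : Fin (B.card l), g ⟨l, k⟩ * B.psi ⟨l, k⟩ x with hT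
  have hTw : ∀ l x, |T l x| ≤ w l := by
    intro l x
    calc |T l x| ≤ ∑ k : Fin (B.card l), |g ⟨l, k⟩ * B.psi ⟨l, k⟩ x| :=
          Finset.abs_sum_le_sum_abs _ _
      _ ≤ ∑ k : Fin (B.card l), u l * |B.psi ⟨l, k⟩ x| := Finset.sum_le_sum fun k _ => by
          rw [abs_mul]
          exact mul_le_mul_of_nonneg_right (hgu ⟨l, k⟩) (abs_nonneg _)
      _ = u l * ∑ k : Fin (B.card l), |B.psi ⟨l, k⟩ x| := by rw [Finset.mul_sum]
      _ ≤ u l * (C * (2 : ℝ) ^ ((l : ℝ) / 2)) :=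
          mul_le_mul_of_nonneg_left (hC l x) (hu0 l)
      _ = w l := by rw [hw]; ring
  have hTs : ∀ x, Summable fun l => T l x := fun x =>
    Summable.of_norm_bounded hws fun l => hTw l x
  have hTm : ∀ l, Measurable (T l) := fun l =>
    Finset.measurable_sum _ fun k _ => (B.measurable_psi _).const_mul _
  set F : ℝ → ℝ := fun x => ∑' l, T l x with hF
  have hFm : Measurable F :=
    measurable_of_tendsto_metrizable
      (fun n => Finset.measurable_sum (Finset.range n) fun l _ => hTm l)
      (tendsto_pi_nhds.2 fun x => by
        simpa using (hTs x).hasSum.tendsto_sum_nat)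
  have hFb : ∀ x, ‖F x‖ ≤ ∑' l, w l := fun x =>
    tsum_of_norm_bounded hws.hasSum fun l => hTw l x
  have hF2 : MemLp F 2 unitMeasure :=
    MemLp.of_bound hFm.aestronglyMeasurable (∑' l, w l) (ae_of_all _ hFb)
  have hpsib : ∀ i x, |B.psi i x| ≤ C * (2 : ℝ) ^ ((i.1 : ℝ) / 2) := fun i x =>
    (Finset.single_le_sum (f := fun k => |B.psi ⟨i.1, k⟩ x|) (fun k _ => abs_nonneg _)
      (Finset.mem_univ i.2)).trans (hC i.1 x)
  have hcoef : ∀ i, ∫ x, F x * B.psi i x ∂unitMeasure = g i := by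
    intro i
    set c := C * (2 : ℝ) ^ ((i.1 : ℝ) / 2)
    have hint : ∀ j, Integrable (fun x => B.psi j x * B.psi i x) unitMeasure := fun j =>
      Integrable.of_bound ((B.measurable_psi j).mul (B.measurable_psi i)).aestronglyMeasurable
        (C * (2 : ℝ) ^ ((j.1 : ℝ) / 2) * c) (ae_of_all _ fun x => by
          rw [Real.norm_eq_abs, abs_mul]
          exact mul_le_mul (hpsib j x) (hpsib i x) (abs_nonneg _) (by positivity))
    have hb : ∀ l x, ‖T l x * B.psi i x‖ ≤ w l * c := fun l x => by
      rw [Real.norm_eq_abs, abs_mul]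
      exact mul_le_mul (hTw l x) (hpsib i x) (abs_nonneg _) ((abs_nonneg _).trans (hTw l x))
    have hTint : ∀ l, ∫ x, T l x * B.psi i x ∂unitMeasure = if l = i.1 then g i else 0 := by
      intro l
      simp only [hT, Finset.sum_mul, mul_assoc]
      rw [integral_finsetSum _ fun k _ => (hint _).const_mul _]
      simp only [integral_const_mul]
      split_ifs with hl
      · subst hl
        rw [Finset.sum_eq_single i.2]
        · rw [hB.norm_sq ⟨i.1, i.2⟩, mul_one]
        · intro k _ hk
          rw [hB.orthogonal ⟨i.1, k⟩ i (fun h => hk (by cases i; simpa using h)), mul_zero]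
        · simp
      · refine Finset.sum_eq_zero fun k _ => ?_
        rw [hB.orthogonal ⟨l, k⟩ i (fun h => hl (congrArg Sigma.fst h)), mul_zero]
    have hsum := hasSum_integral_of_dominated_convergence (μ := unitMeasure)
      (F := fun l x => T l x * B.psi i x) (f := fun x => F x * B.psi i x)
      (fun l _ => w l * c)
      (fun l => ((hTm l).mul (B.measurable_psi i)).aestronglyMeasurable)
      (fun l => ae_of_all _ fun x => hb l x)
      (ae_of_all _ fun x => hws.mul_right c) (integrable_const _)
      (ae_of_all _ fun x => (hTs x).hasSum.mul_right _)
    simp only [hTint] at hsum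
    exact hsum.unique (hasSum_ite_eq i.1 (g i))
  calc B.supNorm g ≤ eLpNorm F ∞ unitMeasure := iInf₂_le F ⟨hF2, hcoef⟩
    _ ≤ _ := by
      rw [eLpNorm_exponent_top, ← tsum_mul_left]
      exact eLpNormEssSup_le_of_ae_bound (ae_of_all _ hFb)

end BoundaryWavelets

/-! ### Symmetry, tails and small balls of the scaled heavy-tailed law. -/

namespace IsHeavyTailed

variable {h : ℝ → ℝ} {c₁ κ : ℝ}

theorem apply_abs (hh : IsHeavyTailed h c₁ κ) (x : ℝ) : h |x| = h x := by
  rcases abs_choice x with hx | hx <;> rw [hx]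
  exact hh.symm x

theorem apply_le_of_abs_le (hh : IsHeavyTailed h c₁ κ) {x y : ℝ} (hxy : |x| ≤ y) :
    h y ≤ h x := by
  rw [← hh.apply_abs x]
  exact hh.antitoneOn (abs_nonneg x) ((abs_nonneg x).trans hxy) hxy

/-- The density is a monotone function of `|x|`. -/
theorem measurable (hh : IsHeavyTailed h c₁ κ) : Measurable h := by
  have h1 : Antitone fun y => h (max y 0) := fun a b hab =>
    hh.antitoneOn (Set.mem_Ici.2 (le_max_right a 0)) (Set.mem_Ici.2 (le_max_right b 0)) (max_le_max_right 0 hab)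
  have h2 : h = (fun y => h (max y 0)) ∘ fun x => |x| := by
    funext x
    simp only [Function.comp_apply, max_eq_left (abs_nonneg x), hh.apply_abs]
  rw [h2]
  exact h1.measurable.comp (by fun_prop)

theorem inv_le (hh : IsHeavyTailed h c₁ κ) {x : ℝ} (hx : 0 ≤ x) :
    1 / h x ≤ Real.exp (c₁ * (1 + Real.log (1 + x) ^ (1 + κ))) := by
  rw [← Real.exp_log (one_div_pos.2 (hh.pos x))]
  exact Real.exp_le_exp.2 (hh.log_le x hx)

end IsHeavyTailed

section HeavyTailedLaw

variable {H : Measure ℝ} {h : ℝ → ℝ} {c₁ κ : ℝ}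

theorem map_neg_eq_self (hH : H = volume.withDensity (fun x => ENNReal.ofReal (h x)))
    (hh : IsHeavyTailed h c₁ κ) : H.map (fun x => -x) = H := by
  have hm : Measurable fun x => ENNReal.ofReal (h x) := hh.measurable.ennreal_ofReal
  ext A hA
  rw [Measure.map_apply measurable_neg hA, hH, withDensity_apply _ hA,
    withDensity_apply _ (measurable_neg hA), ← lintegral_indicator hA,
    ← lintegral_indicator (measurable_neg hA), ← lintegral_neg_eq_self]
  refine lintegral_congr fun x => ?_
  by_cases hx : x ∈ A <;> simp [Set.indicator, hx, hh.symm]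

theorem map_const_mul_neg_eq_self (hH : H = volume.withDensity (fun x => ENNReal.ofReal (h x)))
    (hh : IsHeavyTailed h c₁ κ) (s : ℝ) :
    (H.map (fun x => s * x)).map (fun x => -x) = H.map (fun x => s * x) := by
  conv_rhs => rw [← map_neg_eq_self hH hh]
  rw [Measure.map_map (by fun_prop) (by fun_prop), Measure.map_map (by fun_prop) (by fun_prop)]
  congr 1
  funext x
  simp

theorem exists_tail_le (hH : H = volume.withDensity (fun x => ENNReal.ofReal (h x)))
    (hh : IsHeavyTailed h c₁ κ) {q : ℝ} (hq : 0 < q)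
    (hmom : Integrable (fun x => |x| ^ q * h x)) :
    ∃ m : ℝ, 0 ≤ m ∧ ∀ s t : ℝ, 0 < s → 0 < t →
      H.map (fun x => s * x) {θ | t < |θ|} ≤ ENNReal.ofReal (m * (s / t) ^ q) := by
  refine ⟨∫ x, |x| ^ q * h x, integral_nonneg fun x => mul_nonneg (by positivity) (hh.pos x).le,
    fun s t hs ht => ?_⟩
  have hm : Measurable fun x => ENNReal.ofReal (h x) := hh.measurable.ennreal_ofReal
  have hmq : Measurable fun x : ℝ => ENNReal.ofReal (|x| ^ q) := by fun_prop
  have hE : ∫⁻ x, ENNReal.ofReal (|x| ^ q) ∂H = ENNReal.ofReal (∫ x, |x| ^ q * h x) := by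
    rw [hH, lintegral_withDensity_eq_lintegral_mul _ hm hmq, ofReal_integral_eq_lintegral_ofReal
      hmom (ae_of_all _ fun x => mul_nonneg (by positivity) (hh.pos x).le)]
    refine lintegral_congr fun x => ?_
    rw [Pi.mul_apply, mul_comm, ← ENNReal.ofReal_mul (by positivity)]
  have hst : 0 < (t / s) ^ q := by positivity
  rw [Measure.map_apply (by fun_prop) (measurableSet_lt measurable_const (by fun_prop))]
  calc H {x | t < |s * x|}
      ≤ H {x | ENNReal.ofReal ((t / s) ^ q) ≤ ENNReal.ofReal (|x| ^ q)} := by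
        refine measure_mono fun x hx => ENNReal.ofReal_le_ofReal ?_
        have hx' : t < |s * x| := hx
        rw [abs_mul, abs_of_pos hs] at hx'
        refine Real.rpow_le_rpow (by positivity) ?_ hq.le
        rw [div_le_iff₀ hs, mul_comm]
        exact hx'.le
    _ ≤ (∫⁻ x, ENNReal.ofReal (|x| ^ q) ∂H) / ENNReal.ofReal ((t / s) ^ q) :=
        meas_ge_le_lintegral_div hmq.aemeasurable (ENNReal.ofReal_pos.2 hst).ne'
          ENNReal.ofReal_ne_top
    _ = _ := by
        rw [hE, ← ENNReal.ofReal_div_of_pos hst, div_eq_mul_inv,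
          ← Real.inv_rpow (by positivity), inv_div]

/-- After rescaling, the ball is an interval of length `2 * r / s` contained in `|y| ≤ (|x| + r) /
s`, where the density is at least its value at the far end. -/
theorem ball_le_of_heavyTailed (hH : H = volume.withDensity (fun x => ENNReal.ofReal (h x)))
    (hh : IsHeavyTailed h c₁ κ) {s C r x : ℝ} (hs : 0 < s) (hsC : s ≤ C) (hr : 0 ≤ r) :
    ENNReal.ofReal (2 * r / C * h ((|x| + r) / s)) ≤
      H.map (fun y => s * y) {θ | |x - θ| ≤ r} := by
  have hset : MeasurableSet {y : ℝ | |x - s * y| ≤ r} :=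
    measurableSet_le (by fun_prop) measurable_const
  rw [Measure.map_apply (by fun_prop) (measurableSet_le (by fun_prop) measurable_const)]
  change _ ≤ H {y | |x - s * y| ≤ r}
  have hEq : {y : ℝ | |x - s * y| ≤ r} = Set.Icc ((x - r) / s) ((x + r) / s) := by
    ext y
    simp only [Set.mem_ofPred_eq, Set.mem_Icc, div_le_iff₀ hs, le_div_iff₀ hs, abs_le]
    constructor <;> rintro ⟨h1, h2⟩ <;> constructor <;> linarith
  have hvol : volume {y : ℝ | |x - s * y| ≤ r} = ENNReal.ofReal (2 * r / s) := by
    rw [hEq, Real.volume_Icc]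
    congr 1
    field_simp
    ring
  calc ENNReal.ofReal (2 * r / C * h ((|x| + r) / s))
      ≤ ENNReal.ofReal (h ((|x| + r) / s) * (2 * r / s)) := by
        rw [mul_comm]
        have := (hh.pos ((|x| + r) / s)).le
        gcongr
    _ = ∫⁻ y in {y : ℝ | |x - s * y| ≤ r}, ENNReal.ofReal (h ((|x| + r) / s)) := by
        rw [setLIntegral_const, hvol, ENNReal.ofReal_mul (hh.pos _).le]
    _ ≤ ∫⁻ y in {y : ℝ | |x - s * y| ≤ r}, ENNReal.ofReal (h y) := by
        refine setLIntegral_mono' hset fun y hy => ENNReal.ofReal_le_ofReal ?_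
        refine hh.apply_le_of_abs_le ?_
        have hy' : |x - s * y| ≤ r := hy
        rw [le_div_iff₀ hs]
        calc |y| * s = |s * y| := by rw [abs_mul, abs_of_pos hs, mul_comm]
          _ = |x - (x - s * y)| := by congr 1; ring
          _ ≤ |x| + |x - s * y| := abs_sub _ _
          _ ≤ _ := by linarith
    _ = _ := by rw [hH, withDensity_apply _ hset]

/-- A lower bound for the evidence that is uniform over all prior scales at most `|C|` noise
standard deviations. -/
theorem exists_le_lintegral_exp [IsProbabilityMeasure H] (C : ℝ) :
    ∃ c : ℝ, 0 < c ∧ ∀ (s : ℝ) (v : ℝ≥0), v ≠ 0 → s ^ 2 ≤ C ^ 2 * v →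
      ENNReal.ofReal c ≤
        ∫⁻ θ, ENNReal.ofReal (Real.exp (-θ ^ 2 / (2 * v))) ∂H.map (fun x => s * x) := by
  set I := ∫⁻ x, ENNReal.ofReal (Real.exp (-(C ^ 2 * x ^ 2) / 2)) ∂H with hI
  have hI0 : I ≠ 0 := by
    refine ((lintegral_pos_iff_support (by fun_prop)).2 ?_).ne'
    have : Function.support (fun x : ℝ => ENNReal.ofReal (Real.exp (-(C ^ 2 * x ^ 2) / 2))) =
        Set.univ := Set.eq_univ_of_forall fun x => (ENNReal.ofReal_pos.2 (Real.exp_pos _)).ne'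
    rw [this]
    simp
  have hI1 : I ≠ ∞ := by
    refine ne_top_of_le_ne_top ENNReal.one_ne_top ?_
    calc I ≤ ∫⁻ _, 1 ∂H := lintegral_mono fun x => by
          rw [ENNReal.ofReal_le_one, Real.exp_le_one_iff]
          have : 0 ≤ C ^ 2 * x ^ 2 := by positivity
          linarith
      _ = 1 := by simp
  refine ⟨I.toReal, ENNReal.toReal_pos hI0 hI1, fun s v hv hs => ?_⟩
  have hv' : (0 : ℝ) < v := by positivity
  rw [ENNReal.ofReal_toReal hI1, lintegral_map (by fun_prop) (by fun_prop)]
  refine lintegral_mono fun x => ENNReal.ofReal_le_ofReal (Real.exp_le_exp.2 ?_)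
  rw [div_le_div_iff₀ (by norm_num) (by positivity)]
  nlinarith [mul_le_mul_of_nonneg_right hs (sq_nonneg x)]

end HeavyTailedLaw

/-! ### The product prior, the thresholds at high levels and the union bound. -/

namespace BoundaryWavelets

theorem prior_eq_infinitePi (B : BoundaryWavelets) (H : Measure ℝ) [IsProbabilityMeasure H]
    (s : ℕ → ℝ) : B.prior H s = Measure.infinitePi (fun i : B.Index => H.map (fun x => s i.1 * x)) :=
  Measure.infinitePi_map_pi (μ := fun _ : B.Index => H) (f := fun i x => s i.1 * x)
    fun i => by fun_prop

end BoundaryWavelets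

/-- The threshold `(l + 1)² 2^{-l(1/2+β)}` for the coefficients at the high levels. -/
noncomputable def tailScale (β : ℝ) (l : ℕ) : ℝ :=
  ((l : ℝ) + 1) ^ 2 * (2 : ℝ) ^ (-((l : ℝ) * (1 / 2 + β)))

theorem tailScale_pos (β : ℝ) (l : ℕ) : 0 < tailScale β l := by
  unfold tailScale; positivity

theorem holderScale_le_tailScale (β : ℝ) (l : ℕ) :
    (2 : ℝ) ^ (-((l : ℝ) * (1 / 2 + β))) ≤ tailScale β l := by
  unfold tailScale
  refine le_mul_of_one_le_left (by positivity) ?_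
  exact one_le_pow₀ (by linarith [Nat.cast_nonneg (α := ℝ) l])

theorem add_one_sq_le_four_mul_two_pow (l : ℕ) : ((l : ℝ) + 1) ^ 2 ≤ 4 * 2 ^ l := by
  induction l with
  | zero => norm_num
  | succ n ih =>
    -- The step `(n + 2)² ≤ 2 (n + 1)²` fails at `n = 0` and `n = 1`.
    rcases n with _ | _ | n
    · norm_num
    · norm_num
    · rw [pow_succ (2 : ℝ)]
      push_cast at ih ⊢
      nlinarith [Nat.cast_nonneg (α := ℝ) n]

theorem summable_pow_mul_two_rpow_neg (k : ℕ) {β : ℝ} (hβ : 0 < β) :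
    Summable fun l : ℕ => ((l : ℝ) + 1) ^ k * (2 : ℝ) ^ (-((l : ℝ) * β)) := by
  have hr : ‖(2 : ℝ) ^ (-β)‖ < 1 := by
    rw [Real.norm_eq_abs, abs_of_pos (by positivity)]
    exact Real.rpow_lt_one_of_one_lt_of_neg (by norm_num) (by linarith)
  have h1 := (summable_pow_mul_geometric_of_norm_lt_one k hr)
  have h2 := ((summable_nat_add_iff 1).2 h1).mul_left ((2 : ℝ) ^ β)
  refine h2.congr fun l => ?_
  push_cast
  rw [mul_left_comm, pow_succ ((2 : ℝ) ^ (-β)), mul_left_comm ((2 : ℝ) ^ β),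
    ← Real.rpow_add (by norm_num), add_neg_cancel, Real.rpow_zero, mul_one,
    ← Real.rpow_natCast ((2 : ℝ) ^ (-β)), ← Real.rpow_mul (by norm_num)]
  congr 2
  ring

/-- The surplus `1 / q` in the smoothness of the prior becomes `2^{-l}` after taking the power `q`,
which offsets the number of coefficients at level `l`; the factor `(l + 1)²` of the threshold makes
the rest summable. -/
theorem mul_div_tailScale_rpow_le {m C β q s : ℝ} {l : ℕ} (hm : 0 ≤ m) (hC : 0 ≤ C) (hq : 1 ≤ q)
    (hs : 0 < s) (hsC : s ≤ C * (2 : ℝ) ^ (-((l : ℝ) * (1 / 2 + (β + 1 / q))))) :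
    m * (s / tailScale β l) ^ q ≤ m * C ^ q * ((2 : ℝ) ^ l)⁻¹ * (((l : ℝ) + 1) ^ 2)⁻¹ := by
  have hq0 : 0 < q := by linarith
  have hl : (1 : ℝ) ≤ ((l : ℝ) + 1) ^ 2 :=
    one_le_pow₀ (by linarith [Nat.cast_nonneg (α := ℝ) l])
  have h1 : s / tailScale β l ≤ C * (2 : ℝ) ^ (-((l : ℝ) / q)) * (((l : ℝ) + 1) ^ 2)⁻¹ := by
    rw [div_le_iff₀ (tailScale_pos β l)]
    refine hsC.trans (le_of_eq ?_)
    rw [tailScale, show -((l : ℝ) * (1 / 2 + (β + 1 / q))) =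
      -((l : ℝ) / q) + -((l : ℝ) * (1 / 2 + β)) by ring, Real.rpow_add (by norm_num)]
    field_simp
  have h2 : (s / tailScale β l) ^ q ≤ C ^ q * ((2 : ℝ) ^ l)⁻¹ * (((l : ℝ) + 1) ^ 2)⁻¹ := by
    calc (s / tailScale β l) ^ q
        ≤ (C * (2 : ℝ) ^ (-((l : ℝ) / q)) * (((l : ℝ) + 1) ^ 2)⁻¹) ^ q :=
          Real.rpow_le_rpow (div_nonneg hs.le (tailScale_pos β l).le) h1 hq0.le
      _ = C ^ q * ((2 : ℝ) ^ l)⁻¹ * ((((l : ℝ) + 1) ^ 2)⁻¹) ^ q := by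
          rw [Real.mul_rpow (by positivity) (by positivity), Real.mul_rpow hC (by positivity),
            ← Real.rpow_mul (by norm_num), neg_mul, div_mul_cancel₀ _ hq0.ne',
            Real.rpow_neg (by norm_num), Real.rpow_natCast]
      _ ≤ _ := by
          gcongr
          exact Real.rpow_le_self_of_le_one (by positivity) (inv_le_one_of_one_le₀ hl) hq
  calc _ ≤ m * (C ^ q * ((2 : ℝ) ^ l)⁻¹ * (((l : ℝ) + 1) ^ 2)⁻¹) := by gcongr
    _ = _ := by ring

namespace BoundaryWavelets

theorem tsum_index_le (B : BoundaryWavelets) {C : ℝ} (hC : ∀ l, (B.card l : ℝ) ≤ C * 2 ^ l)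
    (F : ℕ → ℝ≥0∞) :
    ∑' i : B.Index, F i.1 ≤ ∑' l : ℕ, ENNReal.ofReal (C * 2 ^ l) * F l := by
  rw [ENNReal.tsum_sigma']
  refine ENNReal.tsum_le_tsum fun l => ?_
  rw [tsum_fintype]
  change ∑ _k : Fin (B.card l), F l ≤ _
  rw [Finset.sum_const, Finset.card_univ, Fintype.card_fin, nsmul_eq_mul]
  gcongr
  rw [← ENNReal.ofReal_natCast]
  exact ENNReal.ofReal_le_ofReal (hC l)

theorem summable_inv_add_one_sq : Summable fun l : ℕ => (((l : ℝ) + 1) ^ 2)⁻¹ := by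
  have := (summable_nat_add_iff 1).2 (Real.summable_nat_pow_inv.2 (show 1 < 2 by norm_num))
  exact_mod_cast this

theorem summable_tailScale_sq (B : BoundaryWavelets) {β : ℝ} (hβ : 0 < β) :
    Summable fun i : B.Index => tailScale β i.1 ^ 2 := by
  obtain ⟨C, hC0, hC⟩ := B.exists_card_le
  refine (summable_sigma_of_nonneg fun i => sq_nonneg _).2
    ⟨fun l => (hasSum_fintype _).summable, ?_⟩
  refine Summable.of_nonneg_of_le (fun l => tsum_nonneg fun k => sq_nonneg _) (fun l => ?_)
    ((summable_pow_mul_two_rpow_neg 4 (β := 2 * β) (by linarith)).mul_left C)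
  rw [tsum_fintype]
  change ∑ _k : Fin (B.card l), tailScale β l ^ 2 ≤ _
  rw [Finset.sum_const, Finset.card_univ, Fintype.card_fin, nsmul_eq_mul]
  calc (B.card l : ℝ) * tailScale β l ^ 2 ≤ C * 2 ^ l * tailScale β l ^ 2 := by
        gcongr; exact hC l
    _ = _ := by
        rw [tailScale, mul_pow, ← pow_mul, ← Real.rpow_natCast ((2 : ℝ) ^ (_ : ℝ)),
          ← Real.rpow_mul (by norm_num), ← Real.rpow_natCast 2 l]
        rw [show (-((l : ℝ) * (2 * β))) =
          (l : ℝ) + (-((l : ℝ) * (1 / 2 + β)) * (2 : ℕ)) by push_cast; ring,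
          Real.rpow_add (by norm_num)]
        ring

/-- Almost surely, a sequence whose coordinates exceed the thresholds with summable probabilities
is at a square summable distance from the Hölder ball. -/
theorem ae_summable_sub_sq (B : BoundaryWavelets) {β L K : ℝ} (hβ : 0 < β) (hL : 0 ≤ L)
    (p : B.Index → Measure ℝ) [∀ i, IsProbabilityMeasure (p i)]
    (hp : ∀ i, p i {θ | tailScale β i.1 < |θ|} ≤
      ENNReal.ofReal (K * ((2 : ℝ) ^ i.1)⁻¹ * (((i.1 : ℝ) + 1) ^ 2)⁻¹))
    {f₀ : B.Index → ℝ} (hf₀ : f₀ ∈ B.holderBall β L) :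
    ∀ᵐ f ∂Measure.infinitePi p, Summable fun i => (f₀ i - f i) ^ 2 := by
  obtain ⟨C, hC0, hC⟩ := B.exists_card_le
  have hmeas : ∀ i : B.Index, MeasurableSet {θ : ℝ | tailScale β i.1 < |θ|} := fun i =>
    measurableSet_lt measurable_const (by fun_prop)
  have hsum : ∑' i : B.Index, Measure.infinitePi p {f | tailScale β i.1 < |f i|} ≠ ∞ := by
    have h1 : ∀ i : B.Index, Measure.infinitePi p {f | tailScale β i.1 < |f i|} ≤
        ENNReal.ofReal (K * ((2 : ℝ) ^ i.1)⁻¹ * (((i.1 : ℝ) + 1) ^ 2)⁻¹) := fun i => by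
      refine le_trans (le_of_eq ?_) (hp i)
      exact (measurePreserving_eval_infinitePi p i).measure_preimage
        (hmeas i).nullMeasurableSet
    refine ne_top_of_le_ne_top ?_ ((ENNReal.tsum_le_tsum h1).trans (B.tsum_index_le hC
      (fun l => ENNReal.ofReal (K * ((2 : ℝ) ^ l)⁻¹ * (((l : ℝ) + 1) ^ 2)⁻¹))))
    have h2 : ∀ l : ℕ, ENNReal.ofReal (C * 2 ^ l) *
        ENNReal.ofReal (K * ((2 : ℝ) ^ l)⁻¹ * (((l : ℝ) + 1) ^ 2)⁻¹) =
        ENNReal.ofReal (C * K * (((l : ℝ) + 1) ^ 2)⁻¹) := fun l => by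
      rw [← ENNReal.ofReal_mul (by positivity)]
      congr 1
      field_simp
    simp_rw [h2]
    exact (summable_inv_add_one_sq.mul_left (C * K)).tsum_ofReal_ne_top
  -- Borel–Cantelli: almost surely only finitely many coefficients exceed their thresholds.
  filter_upwards [ae_finite_setOfPred_mem hsum] with f hf
  have h2 := (B.summable_tailScale_sq hβ).mul_left ((L + 1) ^ 2)
  refine Summable.of_norm_bounded_eventually h2 (hf.subset fun i hi => ?_)
  by_contra hcon
  refine hi ?_
  have h3 : |f i| ≤ tailScale β i.1 := not_lt.1 hcon
  have h4 : |f₀ i| ≤ L * tailScale β i.1 := (hf₀ i).trans (by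
    rw [mul_comm]; gcongr; exact holderScale_le_tailScale β i.1)
  change ‖(f₀ i - f i) ^ 2‖ ≤ _
  rw [norm_pow, Real.norm_eq_abs, ← mul_pow]
  refine pow_le_pow_left₀ (abs_nonneg _) ((abs_sub _ _).trans ?_) 2
  linarith

/-- The supremum norm event is only bounded above by a countable union of coordinate events, so its
own measurability plays no role. -/
theorem expectedMassOutside_le_tsum (B : BoundaryWavelets) (p : B.Index → Measure ℝ)
    [∀ i, IsProbabilityMeasure (p i)] {n : ℕ} (hn : n ≠ 0) {f₀ : B.Index → ℝ} {r : ℝ}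
    (hf₀ : ∀ᵐ f ∂Measure.infinitePi p, Summable fun i => (f₀ i - f i) ^ 2)
    {S : B.Index → Set ℝ} (hS : ∀ i, MeasurableSet (S i))
    (hr : ∀ f : B.Index → ℝ, (∀ i, f i ∉ S i) → B.supNorm (f - f₀) ≤ ENNReal.ofReal r) :
    B.expectedMassOutside (Measure.infinitePi p) n f₀ r ≤
      ∑' i, ∫⁻ x, coordPosterior (p i) (n : ℝ≥0)⁻¹ (S i) x
        ∂gaussianReal (f₀ i) (n : ℝ≥0)⁻¹ := by
  have hsub : {f : B.Index → ℝ | ENNReal.ofReal r < B.supNorm (f - f₀)} ⊆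
      ⋃ i, {f | f i ∈ S i} := by
    intro f hf
    by_contra hcon
    simp only [Set.mem_iUnion, not_exists] at hcon
    exact absurd (hr f hcon) (not_le.2 hf)
  calc B.expectedMassOutside (Measure.infinitePi p) n f₀ r
      ≤ ∫⁻ X, ∑' i, posterior (B.model n) (Measure.infinitePi p) X {f | f i ∈ S i}
          ∂B.model n f₀ :=
        lintegral_mono fun X => (measure_mono hsub).trans (measure_iUnion_le _)
    _ = ∑' i, ∫⁻ X, posterior (B.model n) (Measure.infinitePi p) X {f | f i ∈ S i}
          ∂B.model n f₀ :=
        lintegral_tsum fun i =>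
          (Kernel.measurable_coe _ (measurable_pi_apply i (hS i))).aemeasurable
    _ = _ := tsum_congr fun i => B.lintegral_posterior_eval p hn hf₀ i (hS i)

end BoundaryWavelets

/-! ### Coefficients at and above the cut-off level. -/

theorem add_one_mul_two_rpow_neg_le {c : ℝ} (hc : 1 / 2 ≤ c) (j : ℕ) :
    ((j : ℝ) + 1) * (2 : ℝ) ^ (-((j : ℝ) * c)) ≤ 2 := by
  have h1 : (2 : ℝ) ^ (-((j : ℝ) * c)) ≤ (2 : ℝ) ^ (-((j : ℝ) * (1 / 2))) :=
    Real.rpow_le_rpow_of_exponent_le (by norm_num) (by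
      have := mul_le_mul_of_nonneg_left hc (Nat.cast_nonneg (α := ℝ) j)
      linarith)
  have h2 : ((2 : ℝ) ^ (-((j : ℝ) * (1 / 2)))) ^ 2 = ((2 : ℝ) ^ j)⁻¹ := by
    rw [← Real.rpow_natCast, ← Real.rpow_mul (by norm_num), ← Real.rpow_natCast 2 j,
      ← Real.rpow_neg (by norm_num)]
    congr 1
    push_cast
    ring
  have h3 : (((j : ℝ) + 1) * (2 : ℝ) ^ (-((j : ℝ) * (1 / 2)))) ^ 2 ≤ 2 ^ 2 := by
    rw [mul_pow, h2, ← div_eq_mul_inv, div_le_iff₀ (by positivity)]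
    have := add_one_sq_le_four_mul_two_pow j
    linarith
  calc _ ≤ ((j : ℝ) + 1) * (2 : ℝ) ^ (-((j : ℝ) * (1 / 2))) := by gcongr
    _ ≤ 2 := le_of_sq_le_sq h3 (by norm_num)

/-- Propagates the condition on the cut-off to all higher levels, through `m + j + 1 ≤ (m + 1) (j +
1)`. -/
theorem mul_add_one_mul_two_rpow_neg_le {c a K : ℝ} (hc : 1 / 2 ≤ c) (ha : 0 ≤ a) {m l : ℕ}
    (h : a * ((m : ℝ) + 1) * (2 : ℝ) ^ (-((m : ℝ) * c)) ≤ K) (hml : m ≤ l) :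
    a * ((l : ℝ) + 1) * (2 : ℝ) ^ (-((l : ℝ) * c)) ≤ 2 * K := by
  obtain ⟨j, rfl⟩ := Nat.exists_eq_add_of_le hml
  have h1 : (((m + j : ℕ) : ℝ) + 1) ≤ ((m : ℝ) + 1) * ((j : ℝ) + 1) := by
    push_cast
    nlinarith [mul_nonneg (Nat.cast_nonneg (α := ℝ) m) (Nat.cast_nonneg (α := ℝ) j)]
  have h2 : (2 : ℝ) ^ (-(((m + j : ℕ) : ℝ) * c)) =
      (2 : ℝ) ^ (-((m : ℝ) * c)) * (2 : ℝ) ^ (-((j : ℝ) * c)) := by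
    rw [← Real.rpow_add (by norm_num)]
    congr 1
    push_cast
    ring
  calc _ ≤ a * (((m : ℝ) + 1) * ((j : ℝ) + 1)) * (2 : ℝ) ^ (-(((m + j : ℕ) : ℝ) * c)) := by
        gcongr
    _ = (a * ((m : ℝ) + 1) * (2 : ℝ) ^ (-((m : ℝ) * c))) *
        (((j : ℝ) + 1) * (2 : ℝ) ^ (-((j : ℝ) * c))) := by rw [h2]; ring
    _ ≤ K * 2 := mul_le_mul h (add_one_mul_two_rpow_neg_le hc j) (by positivity)
        (le_trans (by positivity) h)
    _ = 2 * K := mul_comm _ _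

theorem two_pow_mul_exp_neg_sq_le (l : ℕ) :
    (2 : ℝ) ^ l * Real.exp (-(l : ℝ) ^ 2 / 2) ≤ 4 * Real.exp 2 * (((l : ℝ) + 1) ^ 2)⁻¹ := by
  rw [← div_eq_mul_inv, le_div_iff₀ (by positivity)]
  have h1 := add_one_sq_le_four_mul_two_pow l
  have h2 : (2 : ℝ) ^ l ≤ Real.exp l := by
    rw [← Real.exp_one_pow]
    exact pow_le_pow_left₀ (by norm_num) (by linarith [Real.exp_one_gt_d9]) l
  calc (2 : ℝ) ^ l * Real.exp (-(l : ℝ) ^ 2 / 2) * ((l : ℝ) + 1) ^ 2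
      ≤ Real.exp l * Real.exp (-(l : ℝ) ^ 2 / 2) * (4 * Real.exp l) := by
        gcongr
        exact h1.trans (by gcongr)
    _ = 4 * Real.exp (l + -(l : ℝ) ^ 2 / 2 + l) := by
        rw [Real.exp_add, Real.exp_add]; ring
    _ ≤ 4 * Real.exp 2 := by
        gcongr
        -- The exponent `2 l - l² / 2` is largest at `l = 2`.
        nlinarith [sq_nonneg ((l : ℝ) - 2)]

/-- The envelope of the coefficients of the deviation: `2M` below the cut-off level `m`, a
multiple of the threshold from there on. -/
noncomputable def envelope (β L M : ℝ) (m l : ℕ) : ℝ :=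
  if l < m then 2 * M else (L + 1) * tailScale β l

theorem envelope_nonneg {β L M : ℝ} (hL : 0 ≤ L) (hM : 0 ≤ M) (m l : ℕ) :
    0 ≤ envelope β L M m l := by
  unfold envelope
  have := (tailScale_pos β l).le
  split_ifs <;> positivity

theorem two_rpow_half_mul_tailScale (β : ℝ) (l : ℕ) :
    (2 : ℝ) ^ ((l : ℝ) / 2) * tailScale β l =
      ((l : ℝ) + 1) ^ 2 * (2 : ℝ) ^ (-((l : ℝ) * β)) := by
  rw [tailScale, mul_left_comm, ← Real.rpow_add (by norm_num)]
  congr 2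
  ring

theorem summable_envelope {β : ℝ} (hβ : 0 < β) (L M : ℝ) (m : ℕ) :
    Summable fun l : ℕ => (2 : ℝ) ^ ((l : ℝ) / 2) * envelope β L M m l := by
  refine (summable_congr_cofinite ?_).2
    ((summable_pow_mul_two_rpow_neg 2 hβ).mul_left (L + 1))
  rw [Nat.cofinite_eq_atTop]
  filter_upwards [eventually_ge_atTop m] with l hl
  rw [envelope, if_neg (not_lt.2 hl), mul_left_comm, two_rpow_half_mul_tailScale]

/-- The observation window has half-width `|θ₀| + l / √n`. The Gaussian tail is then `exp(-l² / 2)`,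
which survives summation over `2^l` coefficients, while the cross term in the exponent stays bounded
because `√n |θ₀| (l + 1)` does; hence the factor `l + 1` in the cut-off condition. -/
theorem coordPosterior_tail_le {H : Measure ℝ} [IsProbabilityMeasure H]
    {s β q L C c A K κ₁ : ℝ} {n l : ℕ} (hn : n ≠ 0) (hC : 0 ≤ C) (hq : 0 < q)
    (hL : 0 ≤ L) (hc : 0 < c) (hκ₁ : 0 ≤ κ₁)
    (hneg : (H.map (fun x => s * x)).map (fun x => -x) = H.map (fun x => s * x))
    (hcH : ∀ (s : ℝ) (v : ℝ≥0), v ≠ 0 → s ^ 2 ≤ (2 * C * κ₁) ^ 2 * v →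
      ENNReal.ofReal c ≤
        ∫⁻ θ, ENNReal.ofReal (Real.exp (-θ ^ 2 / (2 * v))) ∂H.map (fun x => s * x))
    (hs : 0 < s) (hsC : s ≤ C * (2 : ℝ) ^ (-((l : ℝ) * (1 / 2 + (β + 1 / q)))))
    (htail : H.map (fun x => s * x) {θ | tailScale β l < |θ|} ≤
      ENNReal.ofReal (K * ((2 : ℝ) ^ l)⁻¹ * (((l : ℝ) + 1) ^ 2)⁻¹))
    (hA : A = 2 * (2 * L * κ₁ * (1 + 2 * L * κ₁)))
    (hl : √(n : ℝ) * ((l : ℝ) + 1) * (2 : ℝ) ^ (-((l : ℝ) * (1 / 2 + β))) ≤ 2 * κ₁)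
    {θ₀ : ℝ} (hθ₀ : |θ₀| ≤ (2 : ℝ) ^ (-((l : ℝ) * (1 / 2 + β))) * L) :
    ∫⁻ x, coordPosterior (H.map (fun x => s * x)) (n : ℝ≥0)⁻¹ {θ | tailScale β l < |θ|} x
        ∂gaussianReal θ₀ (n : ℝ≥0)⁻¹ ≤
      ENNReal.ofReal (2 * Real.exp (-(l : ℝ) ^ 2 / 2)) +
        ENNReal.ofReal (Real.exp A / c) *
          ENNReal.ofReal (K * ((2 : ℝ) ^ l)⁻¹ * (((l : ℝ) + 1) ^ 2)⁻¹) := by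
  have hn' : (0 : ℝ) < n := by positivity
  have hv : ((n : ℝ≥0)⁻¹) ≠ 0 := by simp [hn]
  have hsq : √(n : ℝ) ^ 2 = n := Real.sq_sqrt hn'.le
  have hsn : 0 < √(n : ℝ) := Real.sqrt_pos.2 hn'
  have : IsProbabilityMeasure (H.map (fun x => s * x)) :=
    Measure.isProbabilityMeasure_map (by fun_prop)
  set e := (2 : ℝ) ^ (-((l : ℝ) * (1 / 2 + β))) with he
  have he0 : 0 < e := by positivity
  have hl0 : (0 : ℝ) ≤ l := Nat.cast_nonneg l
  have hse : √(n : ℝ) * e ≤ 2 * κ₁ := le_trans (by nlinarith [mul_pos hsn he0]) hl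
  have hsC' : s ≤ C * e := by
    refine hsC.trans (mul_le_mul_of_nonneg_left ?_ hC)
    refine Real.rpow_le_rpow_of_exponent_le (by norm_num) (neg_le_neg ?_)
    exact mul_le_mul_of_nonneg_left (by linarith [div_pos one_pos hq]) hl0
  have hsv : s ^ 2 ≤ (2 * C * κ₁) ^ 2 * ((n : ℝ≥0)⁻¹ : ℝ≥0) := by
    push_cast
    rw [← div_eq_mul_inv, le_div_iff₀ hn', ← hsq, ← mul_pow]
    refine pow_le_pow_left₀ (by positivity) ?_ 2
    calc s * √n ≤ C * e * √n := by gcongr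
      _ = C * (√n * e) := by ring
      _ ≤ C * (2 * κ₁) := by gcongr
      _ = _ := by ring
  refine (lintegral_coordPosterior_le_of_symmetric (H.map (fun x => s * x)) hneg hv
    (a := l / √n) (by positivity) hc (hcH s _ hv hsv)).trans ?_
  refine add_le_add (le_of_eq ?_) (mul_le_mul' ?_ htail)
  · rw [neg_div, div_pow, hsq]
    congr 3
    push_cast
    field_simp
  · set δ := √(n : ℝ) * |θ₀| with hδ
    have hδ0 : 0 ≤ δ := by positivity
    have hδl : δ * (l + 1) ≤ 2 * L * κ₁ := by
      calc δ * (l + 1) ≤ √(n : ℝ) * (e * L) * (l + 1) :=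
            mul_le_mul_of_nonneg_right (mul_le_mul_of_nonneg_left hθ₀ hsn.le) (by positivity)
        _ = (√(n : ℝ) * (l + 1) * e) * L := by ring
        _ ≤ 2 * κ₁ * L := mul_le_mul_of_nonneg_right hl hL
        _ = _ := by ring
    have hδ1 : δ ≤ 2 * L * κ₁ := le_trans (by nlinarith) hδl
    have h1 : 2 * (|θ₀| + l / √n) * |θ₀| / ((n : ℝ≥0)⁻¹ : ℝ≥0) = 2 * ((δ + l) * δ) := by
      push_cast
      rw [div_inv_eq_mul, hδ]
      calc 2 * (|θ₀| + l / √(n : ℝ)) * |θ₀| * n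
          = 2 * (|θ₀| + l / √(n : ℝ)) * |θ₀| * √(n : ℝ) ^ 2 := by rw [hsq]
        _ = _ := by field_simp
    refine ENNReal.ofReal_le_ofReal (div_le_div_of_nonneg_right (Real.exp_le_exp.2 ?_) hc.le)
    rw [h1, hA]
    have h2 : (δ + l) * δ ≤ δ * (l + 1) * (1 + δ) := by
      nlinarith [mul_nonneg (sq_nonneg δ) hl0]
    have h3 : δ * (l + 1) * (1 + δ) ≤ 2 * L * κ₁ * (1 + 2 * L * κ₁) :=
      mul_le_mul hδl (by linarith) (by positivity) (by positivity)
    linarith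

/-! ### The bound at fixed `n`, combining low and high levels. -/

namespace BoundaryWavelets

theorem exists_expectedMassOutside_le (B : BoundaryWavelets) (hB : B.IsOrthonormalBasis)
    (H : Measure ℝ) [IsProbabilityMeasure H] {h : ℝ → ℝ}
    (hH : H = volume.withDensity (fun x => ENNReal.ofReal (h x)))
    {c₁ κ q : ℝ} (hq : 1 ≤ q) (hh : IsHeavyTailed h c₁ κ)
    (hmom : Integrable (fun x => |x| ^ q * h x))
    {β L : ℝ} (hβ : 0 < β) (hL : 0 < L) {s : ℕ → ℝ} {C : ℝ} (hC : 0 ≤ C)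
    (hs : ∀ l, 0 < s l) (hsC : ∀ l, s l ≤ C * (2 : ℝ) ^ (-((l : ℝ) * (1 / 2 + (β + 1 / q)))))
    {κ₁ : ℝ} (hκ₁ : 0 ≤ κ₁) :
    ∃ D : ℝ, 0 < D ∧ ∀ f₀ ∈ B.holderBall β L, ∀ (n m : ℕ) (M c r : ℝ), n ≠ 0 → 0 ≤ M → 0 < c →
      √(n : ℝ) * ((m : ℝ) + 1) * (2 : ℝ) ^ (-((m : ℝ) * (1 / 2 + β))) ≤ κ₁ →
      (∀ i : B.Index, i.1 < m → ∀ x, |x - f₀ i| ≤ M →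
        ENNReal.ofReal c ≤ H.map (fun y => s i.1 * y) {θ | |x - θ| ≤ √((n : ℝ≥0)⁻¹ : ℝ≥0)}) →
      D * ∑' l : ℕ, (2 : ℝ) ^ ((l : ℝ) / 2) * envelope β L M m l ≤ r →
      B.expectedMassOutside (B.prior H s) n f₀ r ≤
        ENNReal.ofReal (D * 2 ^ m * (2 * Real.exp (-M ^ 2 * n / 2) +
          Real.exp (1 / 2 - M ^ 2 * n / 2) / c)) +
        ∑' l : ℕ, (if m ≤ l then ENNReal.ofReal (D * (((l : ℝ) + 1) ^ 2)⁻¹) else 0) := by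
  have hq0 : 0 < q := by linarith
  obtain ⟨Cs, hCs0, hCs⟩ := exists_supNorm_le hB
  obtain ⟨Cc, hCc0, hCc⟩ := B.exists_card_le
  obtain ⟨mq, hmq0, hmq⟩ := exists_tail_le hH hh hq0 hmom
  obtain ⟨c0, hc0, hc0H⟩ := exists_le_lintegral_exp (H := H) (2 * C * κ₁)
  set K := mq * C ^ q with hK
  have hK0 : 0 ≤ K := by positivity
  set A := 2 * (2 * L * κ₁ * (1 + 2 * L * κ₁)) with hA
  set D₁ := Cc * (2 * (4 * Real.exp 2) + Real.exp A / c0 * K) with hD₁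
  have hD₁0 : 0 ≤ D₁ := by positivity
  -- One constant dominates those of the supremum norm, of the number of coefficients and of the
  -- high levels; it depends neither on `f₀` nor on `n`.
  refine ⟨Cs + Cc + D₁, by positivity, ?_⟩
  intro f₀ hf₀ n m M c r hn hM hc hm hball hr
  have hn' : (0 : ℝ) < n := by positivity
  have hv : ((n : ℝ≥0)⁻¹) ≠ 0 := by simp [hn]
  set p : B.Index → Measure ℝ := fun i => H.map (fun x => s i.1 * x) with hp
  have hpp : ∀ i, IsProbabilityMeasure (p i) := fun i =>
    Measure.isProbabilityMeasure_map (by fun_prop)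
  have htail : ∀ l, H.map (fun x => s l * x) {θ | tailScale β l < |θ|} ≤
      ENNReal.ofReal (K * ((2 : ℝ) ^ l)⁻¹ * (((l : ℝ) + 1) ^ 2)⁻¹) := fun l =>
    (hmq _ _ (hs l) (tailScale_pos β l)).trans
      (ENNReal.ofReal_le_ofReal (mul_div_tailScale_rpow_le hmq0 hC hq (hs l) (hsC l)))
  have hae := B.ae_summable_sub_sq hβ hL.le p (fun i => htail i.1) hf₀
  set S : B.Index → Set ℝ := fun i =>
    if i.1 < m then {θ | 2 * M < |θ - f₀ i|} else {θ | tailScale β i.1 < |θ|} with hS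
  have hSm : ∀ i, MeasurableSet (S i) := by
    intro i
    simp only [hS]
    split_ifs
    · exact measurableSet_lt measurable_const (by fun_prop)
    · exact measurableSet_lt measurable_const (by fun_prop)
  have hsup : ∀ f : B.Index → ℝ, (∀ i, f i ∉ S i) → B.supNorm (f - f₀) ≤ ENNReal.ofReal r := by
    intro f hf
    refine (hCs (f - f₀) (envelope β L M m) (envelope_nonneg hL.le hM m) (fun i => ?_)
      (summable_envelope hβ L M m)).trans (ENNReal.ofReal_le_ofReal (le_trans ?_ hr))
    · have hfi := hf i
      simp only [hS] at hfi
      rw [Pi.sub_apply, envelope]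
      split_ifs with hi
      · rw [if_pos hi] at hfi
        exact not_lt.1 hfi
      · rw [if_neg hi] at hfi
        have h3 : |f i| ≤ tailScale β i.1 := not_lt.1 hfi
        have h4 : |f₀ i| ≤ L * tailScale β i.1 := (hf₀ i).trans (by
          rw [mul_comm]; gcongr; exact holderScale_le_tailScale β i.1)
        have h5 := abs_sub (f i) (f₀ i)
        linarith
    · refine mul_le_mul_of_nonneg_right (by linarith) (tsum_nonneg fun l => ?_)
      exact mul_nonneg (by positivity) (envelope_nonneg hL.le hM m l)
  set Elow := 2 * Real.exp (-M ^ 2 * n / 2) + Real.exp (1 / 2 - M ^ 2 * n / 2) / c with hElow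
  have hElow0 : 0 ≤ Elow := by positivity
  set F : ℕ → ℝ≥0∞ := fun l => if l < m then ENNReal.ofReal Elow else
    ENNReal.ofReal (2 * Real.exp (-(l : ℝ) ^ 2 / 2)) + ENNReal.ofReal (Real.exp A / c0) *
      ENNReal.ofReal (K * ((2 : ℝ) ^ l)⁻¹ * (((l : ℝ) + 1) ^ 2)⁻¹) with hF
  have hcoord : ∀ i, ∫⁻ x, coordPosterior (p i) (n : ℝ≥0)⁻¹ (S i) x
      ∂gaussianReal (f₀ i) (n : ℝ≥0)⁻¹ ≤ F i.1 := by
    intro i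
    simp only [hS, hF]
    split_ifs with hi
    · refine (lintegral_coordPosterior_le_of_prior_ball (p i) hv hM hc (hball i hi)).trans
        (le_of_eq ?_)
      have e1 : -M ^ 2 / (2 * (((n : ℝ≥0)⁻¹ : ℝ≥0) : ℝ)) = -M ^ 2 * n / 2 := by
        push_cast; field_simp
      have e2 : M ^ 2 / (2 * (((n : ℝ≥0)⁻¹ : ℝ≥0) : ℝ)) = M ^ 2 * n / 2 := by
        push_cast; field_simp
      rw [e1, e2]
    · exact coordPosterior_tail_le hn hC hq0 hL.le hc0 hκ₁
        (map_const_mul_neg_eq_self hH hh _) hc0H (hs _) (hsC _) (htail _) hA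
        (mul_add_one_mul_two_rpow_neg_le (by linarith) (Real.sqrt_nonneg _) hm (not_lt.1 hi))
        (hf₀ i)
  have hlevel : ∀ l : ℕ, ENNReal.ofReal (Cc * 2 ^ l) * F l ≤
      (if l < m then ENNReal.ofReal (Cc * 2 ^ l * Elow) else 0) +
      (if m ≤ l then ENNReal.ofReal ((Cs + Cc + D₁) * (((l : ℝ) + 1) ^ 2)⁻¹) else 0) := by
    intro l
    simp only [hF]
    by_cases hl : l < m
    · rw [if_pos hl, if_pos hl, if_neg (not_le.2 hl), add_zero,
        ← ENNReal.ofReal_mul (by positivity)]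
    · rw [if_neg hl, if_neg hl, if_pos (not_lt.1 hl), zero_add,
        ← ENNReal.ofReal_mul (by positivity), ← ENNReal.ofReal_add (by positivity) (by positivity),
        ← ENNReal.ofReal_mul (by positivity)]
      refine ENNReal.ofReal_le_ofReal ?_
      calc Cc * 2 ^ l * (2 * Real.exp (-(l : ℝ) ^ 2 / 2) + Real.exp A / c0 *
            (K * ((2 : ℝ) ^ l)⁻¹ * (((l : ℝ) + 1) ^ 2)⁻¹))
          = Cc * (2 * (2 ^ l * Real.exp (-(l : ℝ) ^ 2 / 2)) +
            Real.exp A / c0 * K * (((l : ℝ) + 1) ^ 2)⁻¹) := by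
            field_simp
        _ ≤ Cc * (2 * (4 * Real.exp 2 * (((l : ℝ) + 1) ^ 2)⁻¹) +
            Real.exp A / c0 * K * (((l : ℝ) + 1) ^ 2)⁻¹) := by
            have := two_pow_mul_exp_neg_sq_le l
            refine mul_le_mul_of_nonneg_left ?_ hCc0.le
            linarith
        _ = D₁ * (((l : ℝ) + 1) ^ 2)⁻¹ := by rw [hD₁]; ring
        _ ≤ _ := mul_le_mul_of_nonneg_right (by linarith) (by positivity)
  have hprior : B.expectedMassOutside (B.prior H s) n f₀ r =
      B.expectedMassOutside (Measure.infinitePi p) n f₀ r := by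
    simp only [B.prior_eq_infinitePi H s, hp]
  rw [hprior]
  calc _ ≤ _ := B.expectedMassOutside_le_tsum p hn hae hSm hsup
    _ ≤ ∑' i : B.Index, F i.1 := ENNReal.tsum_le_tsum hcoord
    _ ≤ ∑' l : ℕ, ENNReal.ofReal (Cc * 2 ^ l) * F l := B.tsum_index_le hCc F
    _ ≤ _ := ENNReal.tsum_le_tsum hlevel
    _ = ∑' l : ℕ, (if l < m then ENNReal.ofReal (Cc * 2 ^ l * Elow) else 0) + _ :=
        ENNReal.tsum_add
    _ ≤ _ := by
        gcongr
        rw [tsum_eq_sum (s := Finset.range m) fun l hl => if_neg (by simpa using hl),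
          Finset.sum_congr rfl fun l hl => if_pos (Finset.mem_range.1 hl),
          ← ENNReal.ofReal_sum_of_nonneg fun l _ => by positivity]
        refine ENNReal.ofReal_le_ofReal ?_
        rw [← Finset.sum_mul, ← Finset.mul_sum, geom_sum_eq (by norm_num)]
        refine mul_le_mul_of_nonneg_right ?_ hElow0
        have : (0 : ℝ) < 2 ^ m := by positivity
        exact mul_le_mul (by linarith) (by linarith)
          (div_nonneg (by linarith [one_le_pow₀ (show (1 : ℝ) ≤ 2 by norm_num) (n := m)])
            (by norm_num)) (by positivity)

end BoundaryWavelets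

/-! ### Choice of the cut-off and asymptotics of the bounds. -/

section Asymptotics

theorem tendsto_tsum_tail (D : ℝ) :
    Tendsto (fun m : ℕ => ∑' l : ℕ,
      (if m ≤ l then ENNReal.ofReal (D * (((l : ℝ) + 1) ^ 2)⁻¹) else 0)) atTop (𝓝 0) := by
  have hs : Summable fun l : ℕ => D * (((l : ℝ) + 1) ^ 2)⁻¹ :=
    BoundaryWavelets.summable_inv_add_one_sq.mul_left D
  have h := ENNReal.tendsto_sum_nat_add (fun l : ℕ => ENNReal.ofReal (D * (((l : ℝ) + 1) ^ 2)⁻¹))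
    hs.tsum_ofReal_ne_top
  refine h.congr fun m => ?_
  rw [← ENNReal.summable.sum_add_tsum_nat_add' (k := m) (f := fun l : ℕ =>
    if m ≤ l then ENNReal.ofReal (D * (((l : ℝ) + 1) ^ 2)⁻¹) else 0),
    Finset.sum_eq_zero fun l hl => if_neg (not_le.2 (Finset.mem_range.1 hl)), zero_add]
  exact tsum_congr fun l => (if_pos (Nat.le_add_left m l)).symm

theorem exists_tsum_envelope_le {β L : ℝ} (hβ : 0 < β) (hL : 0 ≤ L) :
    ∃ Z : ℝ, 0 ≤ Z ∧ ∀ (M : ℝ) (m : ℕ), 0 ≤ M →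
      ∑' l : ℕ, (2 : ℝ) ^ ((l : ℝ) / 2) * envelope β L M m l ≤
        m * (2 : ℝ) ^ ((m : ℝ) / 2) * (2 * M) +
          Z * ((m : ℝ) + 1) ^ 2 * (2 : ℝ) ^ (-((m : ℝ) * β)) := by
  have hZs := summable_pow_mul_two_rpow_neg 2 hβ
  set Z := ∑' l : ℕ, ((l : ℝ) + 1) ^ 2 * (2 : ℝ) ^ (-((l : ℝ) * β)) with hZ
  have hZ0 : 0 ≤ Z := tsum_nonneg fun l => by positivity
  refine ⟨(L + 1) * Z, by positivity, fun M m hM => ?_⟩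
  have hs := summable_envelope hβ L M m
  rw [← hs.sum_add_tsum_nat_add m]
  refine add_le_add ?_ ?_
  · calc ∑ l ∈ Finset.range m, (2 : ℝ) ^ ((l : ℝ) / 2) * envelope β L M m l
        ≤ ∑ l ∈ Finset.range m, (2 : ℝ) ^ ((m : ℝ) / 2) * (2 * M) := by
          refine Finset.sum_le_sum fun l hl => ?_
          have hl' := Finset.mem_range.1 hl
          rw [envelope, if_pos hl']
          have : (l : ℝ) ≤ m := by exact_mod_cast hl'.le
          refine mul_le_mul_of_nonneg_right ?_ (by positivity)
          exact Real.rpow_le_rpow_of_exponent_le (by norm_num) (by linarith)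
      _ = _ := by rw [Finset.sum_const, Finset.card_range, nsmul_eq_mul]; ring
  · set e := ((m : ℝ) + 1) ^ 2 * (2 : ℝ) ^ (-((m : ℝ) * β)) with he
    have hterm : ∀ j : ℕ, (2 : ℝ) ^ (((j + m : ℕ) : ℝ) / 2) * envelope β L M m (j + m) ≤
        (L + 1) * e * (((j : ℝ) + 1) ^ 2 * (2 : ℝ) ^ (-((j : ℝ) * β))) := by
      intro j
      rw [envelope, if_neg (by omega), mul_left_comm, two_rpow_half_mul_tailScale]
      have h1 : (2 : ℝ) ^ (-(((j + m : ℕ) : ℝ) * β)) =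
          (2 : ℝ) ^ (-((m : ℝ) * β)) * (2 : ℝ) ^ (-((j : ℝ) * β)) := by
        rw [← Real.rpow_add (by norm_num)]
        congr 1
        push_cast
        ring
      have h2 : (((j + m : ℕ) : ℝ) + 1) ^ 2 ≤ (((m : ℝ) + 1) * ((j : ℝ) + 1)) ^ 2 := by
        refine pow_le_pow_left₀ (by positivity) ?_ 2
        push_cast
        nlinarith [mul_nonneg (Nat.cast_nonneg (α := ℝ) m) (Nat.cast_nonneg (α := ℝ) j)]
      rw [h1]
      calc _ ≤ (L + 1) * ((((m : ℝ) + 1) * ((j : ℝ) + 1)) ^ 2 *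
            ((2 : ℝ) ^ (-((m : ℝ) * β)) * (2 : ℝ) ^ (-((j : ℝ) * β)))) := by gcongr
        _ = _ := by rw [he]; ring
    calc _ ≤ ∑' j : ℕ, (L + 1) * e * (((j : ℝ) + 1) ^ 2 * (2 : ℝ) ^ (-((j : ℝ) * β))) :=
          ((summable_nat_add_iff m).2 hs).tsum_le_tsum hterm (hZs.mul_left _)
      _ = (L + 1) * e * Z := tsum_mul_left
      _ = _ := by rw [he]; ring

/-- The cut-off level, at which `2^{m(1/2+β)}` is of order `√n log n`. -/
noncomputable def cutoff (β : ℝ) (n : ℕ) : ℕ :=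
  ⌈Real.logb 2 (√(n : ℝ) * Real.log n) / (1 / 2 + β)⌉₊

theorem tendsto_log_natCast_atTop : Tendsto (fun n : ℕ => Real.log n) atTop atTop :=
  Real.tendsto_log_atTop.comp tendsto_natCast_atTop_atTop

theorem tendsto_cutoff {β : ℝ} (hβ : 0 < β) : Tendsto (cutoff β) atTop atTop := by
  refine tendsto_nat_ceil_atTop.comp ?_
  refine Tendsto.atTop_div_const (by linarith) ((Real.tendsto_logb_atTop (by norm_num)).comp ?_)
  exact (Real.tendsto_sqrt_atTop.comp tendsto_natCast_atTop_atTop).atTop_mul_atTop₀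
    tendsto_log_natCast_atTop

/-- With `y = √n log n ≤ n` and `x = log₂ y / (1/2 + β)`, the cut-off lies in `[x, x + 1]`, and
`2^x` is a power of `y`. -/
theorem cutoff_bounds {β : ℝ} (hβ : 0 < β) {n : ℕ} (h1 : 1 ≤ Real.log n)
    (h2 : Real.log n ≤ √(n : ℝ)) :
    √(n : ℝ) * ((cutoff β n : ℝ) + 1) * (2 : ℝ) ^ (-((cutoff β n : ℝ) * (1 / 2 + β))) ≤ 5 ∧
    (cutoff β n : ℝ) + 1 ≤ 5 * Real.log n ∧
    (2 : ℝ) ^ cutoff β n ≤ 2 * (n : ℝ) ^ 2 ∧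
    (2 : ℝ) ^ ((cutoff β n : ℝ) / 2) ≤ 2 * (√(n : ℝ) * Real.log n) ^ (1 / (2 * β + 1)) ∧
    (2 : ℝ) ^ (-((cutoff β n : ℝ) * β)) ≤ (n : ℝ) ^ (-(β / (2 * β + 1))) := by
  have hn : (1 : ℝ) ≤ n := by
    by_contra hcon
    have : Real.log n ≤ 0 := Real.log_nonpos (Nat.cast_nonneg n) (not_le.1 hcon).le
    linarith
  have hn0 : (0 : ℝ) < n := by linarith
  have hsq1 : 1 ≤ √(n : ℝ) := Real.one_le_sqrt.2 hn
  have hsq : √(n : ℝ) * √(n : ℝ) = n := Real.mul_self_sqrt hn0.le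
  set ℓ := Real.log n with hℓ
  set y := √(n : ℝ) * ℓ with hy
  have hsy : √(n : ℝ) ≤ y := le_mul_of_one_le_right (by positivity) h1
  have hy1 : 1 ≤ y := hsq1.trans hsy
  have hy0 : 0 < y := by linarith
  have hyn : y ≤ n := (mul_le_mul_of_nonneg_left h2 (Real.sqrt_nonneg _)).trans hsq.le
  set c := 1 / 2 + β with hc
  have hc0 : 0 < c := by positivity
  set x := Real.logb 2 y / c with hx
  have hlb0 : 0 ≤ Real.logb 2 y := Real.logb_nonneg (by norm_num) hy1
  have hx0 : 0 ≤ x := by positivity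
  have h2y : (2 : ℝ) ^ Real.logb 2 y = y := Real.rpow_logb (by norm_num) (by norm_num) hy0
  have hm : cutoff β n = ⌈x⌉₊ := rfl
  have hxm : x ≤ cutoff β n := hm ▸ Nat.le_ceil x
  have hmx : (cutoff β n : ℝ) ≤ x + 1 := hm ▸ (Nat.ceil_lt_add_one hx0).le
  set m := cutoff β n
  have hpow : ∀ t : ℝ, (2 : ℝ) ^ (x * t) = y ^ (t / c) := fun t => by
    rw [hx, ← h2y, ← Real.rpow_mul (by norm_num), h2y]
    congr 1
    ring
  have hx2 : x ≤ 2 * Real.logb 2 n := by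
    rw [hx, div_le_iff₀ hc0]
    have h3 : Real.logb 2 y ≤ Real.logb 2 n := Real.logb_le_logb_of_le (by norm_num) hy0 hyn
    have h4 : 0 ≤ Real.logb 2 n := hlb0.trans h3
    nlinarith
  -- Here `2 / log 2 < 3`; rounding up and adding one then gives `3 * ℓ + 2 ≤ 5 * ℓ`.
  have hx3 : x ≤ 3 * ℓ := by
    refine hx2.trans ?_
    rw [Real.logb, ← hℓ, mul_div_assoc', div_le_iff₀ (Real.log_pos (by norm_num))]
    nlinarith [Real.log_two_gt_d9]
  have hm5 : (m : ℝ) + 1 ≤ 5 * ℓ := by linarith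
  refine ⟨?_, hm5, ?_, ?_, ?_⟩
  · have h3 : (2 : ℝ) ^ (-((m : ℝ) * c)) ≤ y⁻¹ := by
      rw [Real.rpow_neg (by norm_num)]
      refine inv_anti₀ hy0 ?_
      calc y = (2 : ℝ) ^ (x * c) := by rw [hpow, div_self hc0.ne', Real.rpow_one]
        _ ≤ _ := Real.rpow_le_rpow_of_exponent_le (by norm_num) (by gcongr)
    calc _ ≤ √(n : ℝ) * (5 * ℓ) * y⁻¹ := by gcongr
      _ = 5 * (y * y⁻¹) := by rw [hy]; ring
      _ = 5 := by rw [mul_inv_cancel₀ hy0.ne', mul_one]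
  · calc (2 : ℝ) ^ m = (2 : ℝ) ^ (m : ℝ) := (Real.rpow_natCast _ _).symm
      _ ≤ (2 : ℝ) ^ (2 * Real.logb 2 n + 1) :=
          Real.rpow_le_rpow_of_exponent_le (by norm_num) (by linarith)
      _ = _ := by
          rw [Real.rpow_add (by norm_num), mul_comm (2 : ℝ) (Real.logb 2 n),
            Real.rpow_mul (by norm_num), Real.rpow_logb (by norm_num) (by norm_num) hn0,
            Real.rpow_one, Real.rpow_two, mul_comm]
  · calc (2 : ℝ) ^ ((m : ℝ) / 2) ≤ (2 : ℝ) ^ (x * (1 / 2) + 1) :=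
          Real.rpow_le_rpow_of_exponent_le (by norm_num) (by linarith)
      _ = 2 * y ^ (1 / (2 * β + 1)) := by
          rw [Real.rpow_add (by norm_num), hpow, Real.rpow_one, mul_comm]
          congr 2
          rw [hc]
          field_simp
          ring
  · calc (2 : ℝ) ^ (-((m : ℝ) * β)) ≤ (2 : ℝ) ^ (x * (-β)) :=
          Real.rpow_le_rpow_of_exponent_le (by norm_num) (by nlinarith)
      _ = y ^ (-β / c) := hpow _
      _ ≤ √(n : ℝ) ^ (-β / c) :=
          Real.rpow_le_rpow_of_nonpos (by positivity) hsy
            (div_nonpos_of_nonpos_of_nonneg (by linarith) hc0.le)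
      _ = _ := by
          rw [Real.sqrt_eq_rpow, ← Real.rpow_mul hn0.le]
          congr 1
          rw [hc]
          field_simp
          ring

theorem eventually_log_le_sqrt : ∀ᶠ n : ℕ in atTop, Real.log n ≤ √(n : ℝ) := by
  have := (isLittleO_log_rpow_atTop (r := 1 / 2) (by norm_num)).bound one_pos
  filter_upwards [tendsto_natCast_atTop_atTop.eventually this,
    tendsto_log_natCast_atTop.eventually_ge_atTop 0] with n hn h0
  rw [Real.norm_of_nonneg h0, one_mul, ← Real.sqrt_eq_rpow,
    Real.norm_of_nonneg (Real.sqrt_nonneg _)] at hn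
  exact hn

/-- Low levels cost `(log n)^{4+κ}`: `2 + κ` from `M`, one from the number of levels, at most one
from `2^{m/2}`. A further logarithm absorbs the constants, whence `5 + κ`. -/
theorem eventually_envelope_le_supRate {β L D κ : ℝ} (hβ : 0 < β) (hL : 0 ≤ L) (hD : 0 ≤ D)
    (hκ : 0 ≤ κ) :
    ∀ᶠ n : ℕ in atTop, D * ∑' l : ℕ, (2 : ℝ) ^ ((l : ℝ) / 2) *
      envelope β L (Real.log n ^ (2 + κ) / √(n : ℝ)) (cutoff β n) l ≤ supRate (5 + κ) β n := by
  obtain ⟨Z, hZ0, hZ⟩ := exists_tsum_envelope_le hβ hL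
  filter_upwards [eventually_log_le_sqrt, tendsto_log_natCast_atTop.eventually_ge_atTop 1,
    tendsto_log_natCast_atTop.eventually_ge_atTop (D * (20 + 25 * Z)),
    eventually_gt_atTop 0] with n h2 h1 h3 hn
  obtain ⟨-, hb, -, hd, he⟩ := cutoff_bounds hβ h1 h2
  have hn0 : (0 : ℝ) < n := by exact_mod_cast hn
  set ℓ := Real.log n with hℓ
  have hℓ0 : 0 < ℓ := by linarith
  set m := cutoff β n
  set ρ := β / (2 * β + 1) with hρ
  have hρ0 : 0 ≤ ρ := by positivity
  set N := (n : ℝ) ^ (-ρ) with hN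
  have hN0 : 0 < N := by positivity
  set W := ℓ ^ (4 + κ) with hW
  have hfirst : m * (2 : ℝ) ^ ((m : ℝ) / 2) * (2 * (ℓ ^ (2 + κ) / √(n : ℝ))) ≤ 20 * W * N := by
    have e1 : (√(n : ℝ) * ℓ) ^ (1 / (2 * β + 1)) ≤ √(n : ℝ) * N * ℓ := by
      rw [Real.mul_rpow (by positivity) hℓ0.le]
      have e2 : √(n : ℝ) ^ (1 / (2 * β + 1)) = √(n : ℝ) * N := by
        rw [Real.sqrt_eq_rpow, ← Real.rpow_mul hn0.le, hN, ← Real.rpow_add hn0]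
        congr 1
        rw [hρ]
        field_simp
        ring
      have e3 : ℓ ^ (1 / (2 * β + 1)) ≤ ℓ := by
        conv_rhs => rw [← Real.rpow_one ℓ]
        refine Real.rpow_le_rpow_of_exponent_le h1 ?_
        rw [div_le_one (by positivity)]
        linarith
      rw [e2]
      gcongr
    have e4 : W = ℓ ^ (2 + κ) * ℓ * ℓ := by
      rw [hW, show (4 + κ) = (2 + κ) + 1 + 1 by ring, Real.rpow_add hℓ0, Real.rpow_add hℓ0,
        Real.rpow_one]
    have hsn : 0 < √(n : ℝ) := Real.sqrt_pos.2 hn0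
    calc _ ≤ (5 * ℓ) * (2 * (√(n : ℝ) * N * ℓ)) * (2 * (ℓ ^ (2 + κ) / √(n : ℝ))) := by
          refine mul_le_mul_of_nonneg_right ?_ (by positivity)
          refine mul_le_mul (by linarith) (hd.trans ?_) (by positivity) (by positivity)
          linarith
      _ = _ := by rw [e4]; field_simp; ring
  have hsecond : Z * ((m : ℝ) + 1) ^ 2 * (2 : ℝ) ^ (-((m : ℝ) * β)) ≤ 25 * Z * W * N := by
    have e1 : ((m : ℝ) + 1) ^ 2 ≤ 25 * W := by
      calc ((m : ℝ) + 1) ^ 2 ≤ (5 * ℓ) ^ 2 := pow_le_pow_left₀ (by positivity) hb 2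
        _ = 25 * ℓ ^ (2 : ℝ) := by rw [Real.rpow_two]; ring
        _ ≤ 25 * W := by
          refine mul_le_mul_of_nonneg_left ?_ (by norm_num)
          exact Real.rpow_le_rpow_of_exponent_le h1 (by linarith)
    calc _ ≤ Z * (25 * W) * N := by gcongr
      _ = _ := by ring
  have hrate : ℓ * W * N ≤ supRate (5 + κ) β n := by
    rw [supRate, ← hℓ, Real.div_rpow hℓ0.le hn0.le, ← hρ, hN, Real.rpow_neg hn0.le,
      div_eq_mul_inv, ← mul_assoc]
    refine mul_le_mul_of_nonneg_right ?_ (by positivity)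
    have e1 : ℓ ^ (5 + κ) = ℓ * W := by
      rw [hW, show (5 + κ) = 1 + (4 + κ) by ring, Real.rpow_add hℓ0, Real.rpow_one]
    rw [e1]
    exact le_mul_of_one_le_right (by positivity) (Real.one_le_rpow h1 hρ0)
  calc _ ≤ D * (20 * W * N + 25 * Z * W * N) := by
        refine mul_le_mul_of_nonneg_left ((hZ _ m (by positivity)).trans ?_) hD
        exact add_le_add hfirst hsecond
    _ = D * (20 + 25 * Z) * (W * N) := by ring
    _ ≤ ℓ * (W * N) := by gcongr
    _ = ℓ * W * N := by ring
    _ ≤ _ := hrate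

theorem eventually_log_rpow_le_sqrt (r : ℝ) :
    ∀ᶠ n : ℕ in atTop, Real.log n ^ r ≤ √(n : ℝ) := by
  have := (isLittleO_log_rpow_rpow_atTop r (show (0 : ℝ) < 1 / 2 by norm_num)).bound one_pos
  filter_upwards [tendsto_natCast_atTop_atTop.eventually this,
    tendsto_log_natCast_atTop.eventually_ge_atTop 0] with n hn h0
  rw [one_mul, ← Real.sqrt_eq_rpow, Real.norm_of_nonneg (Real.sqrt_nonneg _)] at hn
  exact (le_abs_self _).trans hn

theorem tendsto_low_level_bound {D C A κ : ℝ} (hD : 0 ≤ D) (hC : 0 ≤ C) (hA : 0 ≤ A)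
    (hκ : 0 ≤ κ) {a : ℕ → ℝ} (ha0 : ∀ n, 0 ≤ a n)
    (ha : ∀ᶠ n : ℕ in atTop, a n ≤ 2 * (n : ℝ) ^ 2) :
    Tendsto (fun n : ℕ => D * a n *
      (2 * Real.exp (-(Real.log n ^ (2 + κ) / √(n : ℝ)) ^ 2 * n / 2) +
        Real.exp (1 / 2 - (Real.log n ^ (2 + κ) / √(n : ℝ)) ^ 2 * n / 2) /
          (2 * (1 / √(n : ℝ)) / C * Real.exp (-(A * Real.log n ^ (2 + 2 * κ))))))
      atTop (𝓝 0) := by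
  set G := D * 2 * (2 + Real.exp (1 / 2) * C / 2) with hG
  have hlim : Tendsto (fun n : ℕ => G * Real.exp (-Real.log n)) atTop (𝓝 0) := by
    have := (Real.tendsto_exp_neg_atTop_nhds_zero.comp tendsto_log_natCast_atTop).const_mul G
    simpa using this
  refine squeeze_zero' (Eventually.of_forall fun n => ?_) ?_ hlim
  · have := ha0 n
    positivity
  filter_upwards [ha, tendsto_log_natCast_atTop.eventually_ge_atTop 1,
    tendsto_log_natCast_atTop.eventually_ge_atTop (2 * (4 + A)), eventually_gt_atTop 0]
    with n han h1 h2 hn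
  have hn0 : (0 : ℝ) < n := by exact_mod_cast hn
  have hn1 : (1 : ℝ) ≤ n := by exact_mod_cast hn
  have hsn : 0 < √(n : ℝ) := Real.sqrt_pos.2 hn0
  have hsq : √(n : ℝ) ^ 2 = n := Real.sq_sqrt hn0.le
  have hsn' : √(n : ℝ) ≤ n := by
    rw [Real.sqrt_le_left hn0.le]
    nlinarith
  set ℓ := Real.log n with hℓ
  have hℓ0 : 0 < ℓ := by linarith
  have hnexp : (n : ℝ) = Real.exp ℓ := (Real.exp_log hn0).symm
  set W := ℓ ^ (2 + 2 * κ) with hW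
  have hW1 : ℓ ≤ W := by
    conv_lhs => rw [← Real.rpow_one ℓ]
    exact Real.rpow_le_rpow_of_exponent_le h1 (by linarith)
  have hMW : (ℓ ^ (2 + κ) / √(n : ℝ)) ^ 2 * n = ℓ ^ 2 * W := by
    rw [div_pow, hsq, div_mul_cancel₀ _ hn0.ne', ← Real.rpow_natCast, ← Real.rpow_mul hℓ0.le,
      ← Real.rpow_natCast ℓ 2, hW, ← Real.rpow_add hℓ0]
    congr 1
    push_cast
    ring
  set T := Real.exp (A * W - ℓ ^ 2 * W / 2) with hT
  have e1 : 2 * Real.exp (-(ℓ ^ (2 + κ) / √(n : ℝ)) ^ 2 * n / 2) ≤ 2 * n * T := by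
    have : Real.exp (-(ℓ ^ (2 + κ) / √(n : ℝ)) ^ 2 * n / 2) ≤ T := by
      refine Real.exp_le_exp.2 ?_
      rw [neg_mul, hMW]
      have : 0 ≤ A * W := mul_nonneg hA (hℓ0.le.trans hW1)
      linarith
    have hT0 : 0 < T := Real.exp_pos _
    nlinarith
  have e2 : Real.exp (1 / 2 - (ℓ ^ (2 + κ) / √(n : ℝ)) ^ 2 * n / 2) /
      (2 * (1 / √(n : ℝ)) / C * Real.exp (-(A * W))) ≤ Real.exp (1 / 2) * C / 2 * n * T := by
    have e3 : Real.exp (1 / 2 - (ℓ ^ (2 + κ) / √(n : ℝ)) ^ 2 * n / 2) /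
      (2 * (1 / √(n : ℝ)) / C * Real.exp (-(A * W))) =
        Real.exp (1 / 2) * C / 2 * √(n : ℝ) * T := by
      rw [hMW, hT, Real.exp_sub, Real.exp_sub, Real.exp_neg]
      rcases eq_or_lt_of_le hC with h0 | h0
      · simp [← h0]
      · field_simp
    rw [e3]
    gcongr
  have e4 : (n : ℝ) ^ 2 * n * T ≤ Real.exp (-ℓ) := by
    rw [hT, hnexp, ← Real.exp_nat_mul, ← Real.exp_add, ← Real.exp_add]
    refine Real.exp_le_exp.2 ?_
    push_cast
    have e5 : 4 + A ≤ ℓ ^ 2 / 2 := by nlinarith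
    nlinarith [mul_le_mul_of_nonneg_right e5 (hℓ0.le.trans hW1)]
  calc _ ≤ D * (2 * (n : ℝ) ^ 2) * (2 * n * T + Real.exp (1 / 2) * C / 2 * n * T) := by
        refine mul_le_mul (mul_le_mul_of_nonneg_left han hD) (add_le_add e1 e2)
          (by positivity) (by positivity)
    _ = G * ((n : ℝ) ^ 2 * n * T) := by rw [hG]; ring
    _ ≤ _ := by gcongr

end Asymptotics

/-! ### Contraction for general scalings, and the two priors. -/

namespace BoundaryWavelets

theorem tendsto_expectedMassOutside (B : BoundaryWavelets) (hB : B.IsOrthonormalBasis)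
    (H : Measure ℝ) [IsProbabilityMeasure H] {h : ℝ → ℝ}
    (hH : H = volume.withDensity (fun x => ENNReal.ofReal (h x)))
    {c₁ κ q : ℝ} (hc₁ : 0 < c₁) (hκ : 0 ≤ κ) (hq : 1 ≤ q) (hh : IsHeavyTailed h c₁ κ)
    (hmom : Integrable (fun x => |x| ^ q * h x))
    {β L : ℝ} (hβ : 0 < β) (hL : 0 < L) {s : ℕ → ℝ} {C A : ℝ} (hC : 0 < C) (hA : 0 ≤ A)
    (hs : ∀ l, 0 < s l) (hsC : ∀ l, s l ≤ C * (2 : ℝ) ^ (-((l : ℝ) * (1 / 2 + (β + 1 / q)))))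
    (hsA : ∀ l : ℕ, 1 / s l ≤ Real.exp (A * ((l : ℝ) + 1) ^ 2))
    {f₀ : B.Index → ℝ} (hf₀ : f₀ ∈ B.holderBall β L) :
    Tendsto (fun n : ℕ => B.expectedMassOutside (B.prior H s) n f₀ (supRate (5 + κ) β n))
      atTop (𝓝 0) := by
  obtain ⟨D, hD, hbound⟩ := B.exists_expectedMassOutside_le hB H hH hq hh hmom hβ hL hC.le hs hsC
    (κ₁ := 5) (by norm_num)
  -- Below the cut-off `l + 1 ≤ 5 log n`, so `A (l + 1)² ≤ 25 A (log n)²`. The argument of `h` is at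
  -- most `(L + 2) / s_l`, and adding one inside the logarithm gives `L + 3`.
  set A₂ := Real.log (L + 3) + 25 * A with hA₂
  have hlogL : 0 ≤ Real.log (L + 3) := Real.log_nonneg (by linarith)
  have hA₂0 : 0 ≤ A₂ := by positivity
  set A₃ := c₁ * (1 + A₂ ^ (1 + κ)) with hA₃
  have hA₃0 : 0 ≤ A₃ := by positivity
  have hsC1 : ∀ l, s l ≤ C := fun l => (hsC l).trans (by
    refine mul_le_of_le_one_right hC.le (Real.rpow_le_one_of_one_le_of_nonpos (by norm_num) ?_)
    have : 0 ≤ (l : ℝ) * (1 / 2 + (β + 1 / q)) := by positivity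
    linarith)
  have hcut : ∀ᶠ n : ℕ in atTop, (2 : ℝ) ^ cutoff β n ≤ 2 * (n : ℝ) ^ 2 := by
    filter_upwards [eventually_log_le_sqrt, tendsto_log_natCast_atTop.eventually_ge_atTop 1]
      with n h2 h1
    exact (cutoff_bounds hβ h1 h2).2.2.1
  have hlow := ENNReal.tendsto_ofReal (tendsto_low_level_bound (D := D) (C := C) (A := A₃)
    hD.le hC.le hA₃0 hκ (a := fun n => (2 : ℝ) ^ cutoff β n) (fun n => by positivity) hcut)
  have hhigh := (tendsto_tsum_tail D).comp (tendsto_cutoff hβ)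
  have hlim := hlow.add hhigh
  rw [ENNReal.ofReal_zero, add_zero] at hlim
  refine tendsto_of_tendsto_of_tendsto_of_le_of_le' tendsto_const_nhds hlim
    (Eventually.of_forall fun n => bot_le) ?_
  filter_upwards [eventually_log_le_sqrt, tendsto_log_natCast_atTop.eventually_ge_atTop 1,
    eventually_log_rpow_le_sqrt (2 + κ), eventually_gt_atTop 0,
    eventually_envelope_le_supRate (β := β) (L := L) hβ hL.le hD.le hκ]
    with n h2 h1 h3 hn hrate
  have hn0 : (0 : ℝ) < n := by exact_mod_cast hn
  have hsn : 0 < √(n : ℝ) := Real.sqrt_pos.2 hn0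
  obtain ⟨hca, hcb, -, -, -⟩ := cutoff_bounds hβ h1 h2
  refine hbound f₀ hf₀ n (cutoff β n) _ _ _ hn.ne' (by positivity) (by positivity) hca ?_ hrate
  intro i hi x hx
  have hr : √(((n : ℝ≥0)⁻¹ : ℝ≥0) : ℝ) = 1 / √(n : ℝ) := by
    push_cast
    rw [Real.sqrt_inv, one_div]
  have hr1 : 1 / √(n : ℝ) ≤ 1 := by
    rw [div_le_one hsn]
    exact h1.trans h2
  have hM1 : Real.log n ^ (2 + κ) / √(n : ℝ) ≤ 1 := (div_le_one hsn).2 h3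
  have hfL : |f₀ i| ≤ L := (hf₀ i).trans (by
    refine mul_le_of_le_one_left hL.le (Real.rpow_le_one_of_one_le_of_nonpos (by norm_num) ?_)
    have : 0 ≤ (i.1 : ℝ) * (1 / 2 + β) := by positivity
    linarith)
  have hxL : |x| + 1 / √(n : ℝ) ≤ L + 2 := by
    have : |x| ≤ |x - f₀ i| + |f₀ i| := by simpa using abs_add_le (x - f₀ i) (f₀ i)
    linarith
  rw [hr]
  refine le_trans (ENNReal.ofReal_le_ofReal ?_) (ball_le_of_heavyTailed hH hh (x := x)
    (hs i.1) (hsC1 i.1) (show 0 ≤ 1 / √(n : ℝ) by positivity))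
  refine mul_le_mul_of_nonneg_left ?_ (by positivity)
  have hsi := hs i.1
  set ℓ := Real.log n with hℓ
  have hℓ0 : 0 < ℓ := by linarith
  set W := ℓ ^ (2 + 2 * κ) with hW
  have hW1 : 1 ≤ W := Real.one_le_rpow h1 (by linarith)
  set z := (L + 2) / s i.1 with hz
  have hz0 : 0 ≤ z := by positivity
  have hlz : Real.log (1 + z) ≤ A₂ * ℓ ^ 2 := by
    have hi' : (i.1 : ℝ) + 1 ≤ 5 * ℓ := by
      have : (i.1 : ℝ) ≤ cutoff β n := by exact_mod_cast hi.le
      linarith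
    have g1 : 1 + z ≤ (L + 3) * Real.exp (A * ((i.1 : ℝ) + 1) ^ 2) := by
      have g2 := hsA i.1
      have g3 : 1 ≤ Real.exp (A * ((i.1 : ℝ) + 1) ^ 2) := Real.one_le_exp (by positivity)
      have g4 : z = (L + 2) * (1 / s i.1) := by rw [hz]; ring
      rw [g4]
      nlinarith
    calc Real.log (1 + z) ≤ Real.log ((L + 3) * Real.exp (A * ((i.1 : ℝ) + 1) ^ 2)) :=
          Real.log_le_log (by linarith) g1
      _ = Real.log (L + 3) + A * ((i.1 : ℝ) + 1) ^ 2 := by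
          rw [Real.log_mul (by linarith) (Real.exp_pos _).ne', Real.log_exp]
      _ ≤ Real.log (L + 3) * ℓ ^ 2 + A * (5 * ℓ) ^ 2 := by
          refine add_le_add (le_mul_of_one_le_right hlogL (one_le_pow₀ h1)) ?_
          gcongr
      _ = A₂ * ℓ ^ 2 := by rw [hA₂]; ring
  have hlz0 : 0 ≤ Real.log (1 + z) := Real.log_nonneg (by linarith)
  have hexp : c₁ * (1 + Real.log (1 + z) ^ (1 + κ)) ≤ A₃ * W := by
    have g1 : Real.log (1 + z) ^ (1 + κ) ≤ A₂ ^ (1 + κ) * W := by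
      calc _ ≤ (A₂ * ℓ ^ 2) ^ (1 + κ) := Real.rpow_le_rpow hlz0 hlz (by linarith)
        _ = _ := by
          rw [Real.mul_rpow hA₂0 (by positivity), ← Real.rpow_natCast ℓ 2,
            ← Real.rpow_mul hℓ0.le, hW]
          congr 2
          push_cast
          ring
    calc _ ≤ c₁ * (W + A₂ ^ (1 + κ) * W) := by gcongr
      _ = _ := by rw [hA₃]; ring
  have hhz : Real.exp (-(A₃ * W)) ≤ h z := by
    rw [Real.exp_neg]
    refine inv_le_of_inv_le₀ (hh.pos z) ?_
    rw [← one_div]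
    exact (hh.inv_le hz0).trans (Real.exp_le_exp.2 hexp)
  refine hhz.trans (hh.apply_le_of_abs_le ?_)
  rw [abs_of_nonneg (by positivity)]
  exact div_le_div_of_nonneg_right hxL hsi.le

end BoundaryWavelets

/-- Completing the square in `l` gives the constant; `2^{-l²}` decays faster than every exponential
in `l`, so this scaling adapts to every `β`. -/
theorem otScale_le {β q : ℝ} (l : ℕ) :
    otScale l ≤ (2 : ℝ) ^ ((1 / 2 + (β + 1 / q)) ^ 2 / 4) *
      (2 : ℝ) ^ (-((l : ℝ) * (1 / 2 + (β + 1 / q)))) := by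
  rw [otScale, ← Real.rpow_add (by norm_num)]
  refine Real.rpow_le_rpow_of_exponent_le (by norm_num) ?_
  nlinarith [sq_nonneg ((l : ℝ) - (1 / 2 + (β + 1 / q)) / 2)]

theorem one_div_two_rpow_neg_le_exp {t A : ℝ} (h : t ≤ A) (hA : 0 ≤ A) :
    1 / (2 : ℝ) ^ (-t) ≤ Real.exp A := by
  rw [Real.rpow_neg (by norm_num), one_div, inv_inv, Real.rpow_def_of_pos (by norm_num)]
  refine Real.exp_le_exp.2 ?_
  have h1 := Real.log_two_lt_d9
  have h2 := Real.log_two_gt_d9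
  nlinarith

theorem theorem3 (B : BoundaryWavelets) (hB : B.IsOrthonormalBasis)
    (H : Measure ℝ) [IsProbabilityMeasure H] (h : ℝ → ℝ)
    (hH : H = volume.withDensity (fun x => ENNReal.ofReal (h x)))
    (c₁ κ q : ℝ) (hc₁ : 0 < c₁) (hκ : 0 ≤ κ) (hq : 1 ≤ q)
    (hh : IsHeavyTailed h c₁ κ)
    (hmom : Integrable (fun x => |x| ^ q * h x))
    (β L : ℝ) (hβ : 0 < β) (hL : 0 < L) :
    (∃ d : ℝ, 0 < d ∧ ∀ f₀ ∈ B.holderBall β L,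
      Tendsto (fun n : ℕ => B.expectedMassOutside (B.prior H otScale) n f₀ (supRate d β n))
        atTop (𝓝 0)) ∧
    (∀ α : ℝ, β + 1 / q ≤ α → ∃ d : ℝ, 0 < d ∧ ∀ f₀ ∈ B.holderBall β L,
      Tendsto (fun n : ℕ => B.expectedMassOutside (B.prior H (htScale α)) n f₀ (supRate d β n))
        atTop (𝓝 0)) := by
  refine ⟨⟨5 + κ, by positivity, fun f₀ hf₀ => ?_⟩,
    fun α hα => ⟨5 + κ, by positivity, fun f₀ hf₀ => ?_⟩⟩
  · refine B.tendsto_expectedMassOutside hB H hH hc₁ hκ hq hh hmom hβ hL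
      (C := (2 : ℝ) ^ ((1 / 2 + (β + 1 / q)) ^ 2 / 4)) (A := 1) (by positivity) zero_le_one
      (fun l => by unfold otScale; positivity) (fun l => otScale_le l) (fun l => ?_) hf₀
    refine one_div_two_rpow_neg_le_exp ?_ (by positivity)
    nlinarith [Nat.cast_nonneg (α := ℝ) l]
  · have hα0 : 0 ≤ α := le_trans (by positivity) hα
    refine B.tendsto_expectedMassOutside hB H hH hc₁ hκ hq hh hmom hβ hL
      (C := 1) (A := 1 / 2 + α) one_pos (by positivity)
      (fun l => by unfold htScale; positivity) (fun l => ?_) (fun l => ?_) hf₀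
    · rw [one_mul, htScale]
      refine Real.rpow_le_rpow_of_exponent_le (by norm_num) (neg_le_neg ?_)
      exact mul_le_mul_of_nonneg_left (by linarith) (Nat.cast_nonneg l)
    · refine one_div_two_rpow_neg_le_exp ?_ (by positivity)
      rw [mul_comm]
      refine mul_le_mul_of_nonneg_left ?_ (by positivity)
      nlinarith [Nat.cast_nonneg (α := ℝ) l]
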